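/- Let $m>1$ be an integer with $m\not\equiv 2 \pmod 4$, and let $r$ be the number of distinct prime factors of $m$. Let $\mathbf A_m$ be the free abelian group on the symbols $[a]$, $a\in\frac1m\mathbb Z/\mathbb Z\subset\mathbb Q/\mathbb Z$. Define the universal distribution and the universal predistribution (of rank $1$ and level $m$) by $$U_m=\mathbf A_m\Big/\Big\langle [a]-\sum_{nb=a}[b] : n\mid m,\ a\in\tfrac nm\mathbb Z/\mathbb Z\Big\rangle,\qquad \mathcal O_m=\mathbf A_m\Big/\Big\langle \sum_{nb=a}[b] : n\mid m,\ n>1,\ a\in\tfrac nm\mathbb Z/\mathbb Z\Big\rangle,$$ where the sums run over $b\in\mathbb Q/\mathbb Z$. The group $G_m=(\mathbb Z/m\mathbb Z)^\times=\mathrm{Gal}(\mathbb Q(\zeta_m)/\mathbb Q)$ acts on both by $\sigma_t[a]=[ta]$; let $c=\sigma_{-1}$ and $J=\{1,c\}\subseteq G_m$. Then for $i=1,2$: 1. $J$ acts trivially on the group cohomology $H^i(J,\mathcal O_m)$ and $H^i(J,U_m)$ (the action of $j\in J$ being the one induced by $x\mapsto jx$ on coefficients, conjugation on the abelian group $J$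 being trivial); 2. $H^i(J,\mathcal O_m)\cong\mathbb Z/2\mathbb Z$ if $m$ is a power of $2$, and $H^i(J,\mathcal O_m)=0$ otherwise; 3. $H^i(J,U_m)\cong(\mathbb Z/2\mathbb Z)^{2^{r-1}}$. -/

import Mathlib

namespace UnivDist

/-- The group `ℚ/ℤ`. -/
abbrev QmodZ : Type := AddCircle (1 : ℚ)

/-- The subgroup `(n/m)ℤ/ℤ` of `ℚ/ℤ`, generated by the class of `n/m`
(used for `n ∣ m`). -/
def fracGroup (n m : ℕ) : AddSubgroup QmodZ :=
  AddSubgroup.zmultiples (((n : ℚ) / (m : ℚ) : ℚ) : QmodZ)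

/-- The group `(1/m)ℤ/ℤ`. -/
abbrev Level (m : ℕ) : Type := fracGroup 1 m

theorem level_nsmul_eq_zero (m : ℕ) [NeZero m] (x : Level m) : m • x = 0 := by
  obtain ⟨x, hx⟩ := x
  obtain ⟨k, rfl⟩ := AddSubgroup.mem_zmultiples_iff.mp hx
  apply Subtype.ext
  have hm : (m : ℚ) ≠ 0 := by exact_mod_cast NeZero.ne m
  change m • (k • (((1 : ℕ) : ℚ) / (m : ℚ) : ℚ) : QmodZ) = 0
  rw [smul_comm, ← AddCircle.coe_nsmul]
  have h : m • (((1 : ℕ) : ℚ) / (m : ℚ)) = 1 := by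
    rw [nsmul_eq_mul]; push_cast; field_simp
  rw [h, AddCircle.coe_period, smul_zero]

instance levelFinite (m : ℕ) [NeZero m] : Finite (Level m) := by
  have h : IsOfFinAddOrder ((((1 : ℕ) : ℚ) / (m : ℚ) : ℚ) : QmodZ) := by
    refine isOfFinAddOrder_iff_nsmul_eq_zero.mpr ⟨m, Nat.pos_of_ne_zero (NeZero.ne m), ?_⟩
    exact congrArg Subtype.val
      (level_nsmul_eq_zero m ⟨_, AddSubgroup.mem_zmultiples _⟩)
  exact Set.finite_coe_iff.mpr (finite_zmultiples.mpr h)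

noncomputable instance levelFintype (m : ℕ) [NeZero m] : Fintype (Level m) :=
  Fintype.ofFinite _

/-- `𝐀_m`: the free abelian group on the symbols `[a]`, `a ∈ (1/m)ℤ/ℤ`;
`[a]` is `Finsupp.single a 1`. -/
abbrev FreeLevel (m : ℕ) : Type := Level m →₀ ℤ

/-- `(1/m)ℤ/ℤ` contains every solution in `ℚ/ℤ` of `n b = a` when `n ∣ m` and
`a ∈ (n/m)ℤ/ℤ`. -/
theorem mem_level_of_nsmul_mem (n m : ℕ) [NeZero m] (hn : n ∣ m) (b : QmodZ)
    (hb : n • b ∈ fracGroup n m) : b ∈ fracGroup 1 m := by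
  obtain ⟨q, rfl⟩ := QuotientAddGroup.mk_surjective b
  obtain ⟨k, hk⟩ := AddSubgroup.mem_zmultiples_iff.mp hb
  obtain ⟨d, rfl⟩ := hn
  have hm : ((n * d : ℕ) : ℚ) ≠ 0 := by exact_mod_cast NeZero.ne (n * d)
  push_cast at hm
  have hn0 : (n : ℚ) ≠ 0 := left_ne_zero_of_mul hm
  have hd0 : (d : ℚ) ≠ 0 := right_ne_zero_of_mul hm
  change (k • (((n : ℚ) / ((n * d : ℕ) : ℚ) : ℚ) : QmodZ)) = n • ((q : ℚ) : QmodZ) at hk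
  rw [← AddCircle.coe_zsmul, ← AddCircle.coe_nsmul, ← sub_eq_zero, ← AddCircle.coe_sub,
    AddCircle.coe_eq_zero_iff] at hk
  obtain ⟨l, hl⟩ := hk
  refine AddSubgroup.mem_zmultiples_iff.mpr ⟨k - l * d, ?_⟩
  change ((k - l * d : ℤ) • ((((1 : ℕ) : ℚ) / ((n * d : ℕ) : ℚ) : ℚ) : QmodZ)) = (q : QmodZ)
  rw [← AddCircle.coe_zsmul]
  congr 1
  simp only [zsmul_eq_mul, nsmul_eq_mul, mul_one] at hl
  push_cast at hl
  simp only [zsmul_eq_mul]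
  push_cast
  rw [hl]
  field_simp
  ring

open Classical in
/-- `∑_{nb = a} [b]`.  For `n ∣ m` and `a ∈ (n/m)ℤ/ℤ` this is the sum over all `b ∈ ℚ/ℤ` with
`n b = a`, by `mem_level_of_nsmul_mem`. -/
noncomputable def fiberSum (m n : ℕ) [NeZero m] (a : Level m) : FreeLevel m :=
  ∑ b : Level m with n • b = a, Finsupp.single b 1

/-- The relations `[a] - ∑_{nb = a} [b]`, `n ∣ m`, `a ∈ (n/m)ℤ/ℤ`. -/
noncomputable def distRel (m : ℕ) [NeZero m] : Submodule ℤ (FreeLevel m) :=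
  Submodule.span ℤ {x | ∃ (n : ℕ) (a : Level m), n ∣ m ∧ (a : QmodZ) ∈ fracGroup n m ∧
    x = Finsupp.single a 1 - fiberSum m n a}

/-- The relations `∑_{nb = a} [b]`, `n ∣ m`, `n > 1`, `a ∈ (n/m)ℤ/ℤ`. -/
noncomputable def predistRel (m : ℕ) [NeZero m] : Submodule ℤ (FreeLevel m) :=
  Submodule.span ℤ {x | ∃ (n : ℕ) (a : Level m), n ∣ m ∧ 1 < n ∧ (a : QmodZ) ∈ fracGroup n m ∧
    x = fiberSum m n a}

/-- `U_m`, the universal distribution of level `m`. -/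
abbrev U (m : ℕ) [NeZero m] : Type := FreeLevel m ⧸ distRel m

/-- `𝒪_m`, the universal predistribution of level `m`. -/
abbrev O (m : ℕ) [NeZero m] : Type := FreeLevel m ⧸ predistRel m

theorem val_nsmul_congr (m : ℕ) [NeZero m] {i j : ℕ} (h : i ≡ j [MOD m]) (x : Level m) :
    i • x = j • x := by
  have key : ∀ i : ℕ, i • x = (i % m) • x := fun i => by
    conv_lhs => rw [← Nat.div_add_mod i m]
    rw [add_nsmul, mul_comm, mul_nsmul', level_nsmul_eq_zero, smul_zero, zero_add]
  rw [key i, key j, h]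

/-- The action of `G_m = (ℤ/m)ˣ` on `𝐀_m`: `σ_t [a] = [t a]`. -/
noncomputable def rhoA (m : ℕ) [NeZero m] : Representation ℤ (ZMod m)ˣ (FreeLevel m) where
  toFun t := Finsupp.lmapDomain ℤ ℤ (fun a : Level m => (t : ZMod m).val • a)
  map_one' := by
    ext a : 1
    ext : 1
    have h : (1 : ZMod m).val • a = a := by
      have := val_nsmul_congr m (i := (1 : ZMod m).val) (j := 1)
        ((ZMod.natCast_eq_natCast_iff _ _ _).mp (by simp)) a
      rw [this, one_smul]
    simp [h]
  map_mul' s t := by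
    ext a : 1
    ext : 1
    have h : ((s : ZMod m) * (t : ZMod m)).val • a
        = (s : ZMod m).val • ((t : ZMod m).val • a) := by
      rw [← mul_smul]
      exact val_nsmul_congr m ((ZMod.natCast_eq_natCast_iff _ _ _).mp (by simp)) a
    simp [h]

theorem rhoA_single (m : ℕ) [NeZero m] (t : (ZMod m)ˣ) (a : Level m) :
    rhoA m t (Finsupp.single a 1) = Finsupp.single ((t : ZMod m).val • a) 1 := by
  simp [rhoA]

theorem unit_smul_cancel (m : ℕ) [NeZero m] (s t : (ZMod m)ˣ) (h : s * t = 1) (a : Level m) :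
    (s : ZMod m).val • ((t : ZMod m).val • a) = a := by
  rw [← mul_smul]
  conv_rhs => rw [← one_smul ℕ a]
  refine val_nsmul_congr m ((ZMod.natCast_eq_natCast_iff _ _ _).mp ?_) a
  have := congrArg Units.val h
  simpa using this

theorem rhoA_fiberSum (m n : ℕ) [NeZero m] (t : (ZMod m)ˣ) (a : Level m) :
    rhoA m t (fiberSum m n a) = fiberSum m n ((t : ZMod m).val • a) := by
  classical
  simp only [fiberSum, map_sum, rhoA_single]
  refine Finset.sum_bij' (fun b _ => (t : ZMod m).val • b)
    (fun b _ => ((t⁻¹ : (ZMod m)ˣ) : ZMod m).val • b) ?_ ?_ ?_ ?_ ?_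
  · intro b hb
    simp only [Finset.mem_filter, Finset.mem_univ, true_and] at hb ⊢
    rw [smul_comm, hb]
  · intro b hb
    simp only [Finset.mem_filter, Finset.mem_univ, true_and] at hb ⊢
    rw [smul_comm, hb, unit_smul_cancel m _ _ (inv_mul_cancel t)]
  · intro b _
    exact unit_smul_cancel m _ _ (inv_mul_cancel t) b
  · intro b _
    exact unit_smul_cancel m _ _ (mul_inv_cancel t) b
  · intro b _
    rfl

theorem distRel_le_comap (m : ℕ) [NeZero m] (t : (ZMod m)ˣ) :
    distRel m ≤ (distRel m).comap (rhoA m t) := by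
  refine Submodule.span_le.mpr ?_
  rintro _ ⟨n, a, hn, ha, rfl⟩
  refine Submodule.subset_span ⟨n, (t : ZMod m).val • a, hn, ?_, ?_⟩
  · exact AddSubgroup.nsmul_mem _ ha _
  · rw [map_sub, rhoA_single, rhoA_fiberSum]

theorem predistRel_le_comap (m : ℕ) [NeZero m] (t : (ZMod m)ˣ) :
    predistRel m ≤ (predistRel m).comap (rhoA m t) := by
  refine Submodule.span_le.mpr ?_
  rintro _ ⟨n, a, hn, hn1, ha, rfl⟩
  refine Submodule.subset_span ⟨n, (t : ZMod m).val • a, hn, hn1, ?_, ?_⟩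
  · exact AddSubgroup.nsmul_mem _ ha _
  · rw [rhoA_fiberSum]

/-- The induced action of `G_m` on `U_m`. -/
noncomputable def rhoU (m : ℕ) [NeZero m] : Representation ℤ (ZMod m)ˣ (U m) :=
  (rhoA m).quotient (distRel m) (distRel_le_comap m)

/-- The induced action of `G_m` on `𝒪_m`. -/
noncomputable def rhoO (m : ℕ) [NeZero m] : Representation ℤ (ZMod m)ˣ (O m) :=
  (rhoA m).quotient (predistRel m) (predistRel_le_comap m)

/-- `J = {1, c}` with `c = σ_{-1}`. -/
def J (m : ℕ) : Subgroup (ZMod m)ˣ := Subgroup.zpowers (-1)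

/-- `U_m` as a `J`-module. -/
noncomputable def repU (m : ℕ) [NeZero m] : Rep ℤ (J m) :=
  Rep.of ((rhoU m).comp (J m).subtype)

/-- `𝒪_m` as a `J`-module. -/
noncomputable def repO (m : ℕ) [NeZero m] : Rep ℤ (J m) :=
  Rep.of ((rhoO m).comp (J m).subtype)

/-- `J` acts trivially on `Hⁱ(J, M)`. The element `j` acts through conjugation on `J`, which is the
identity because `J` is commutative, and through the endomorphism `x ↦ j x` of `M`. -/
def ActsTriviallyOnCohomology {m : ℕ} (M : Rep ℤ (J m)) (i : ℕ) : Prop :=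
  ∀ j : J m, groupCohomology.map (MonoidHom.id (J m)) (M.applyAsHom j) i =
    CategoryTheory.CategoryStruct.id (groupCohomology M i)

end UnivDist

namespace UnivDist

open CategoryTheory

/-! ### Group cohomology in degrees one and two; groups of order two -/

section CyclicOrderTwo

universe u
variable {k G : Type u} [CommRing k] [CommGroup G]

/-! Triviality of the action on cohomology holds for every commutative group, by explicit
coboundaries. Since `J` has order two, its cohomology in degrees 1 and 2 is `ker (1 - ε c) / im (1 +
ε c)` for `ε = -1` and `ε = 1`. It is killed by 2, so only its order, `tateIndex`, has to be found.

For `U m`, split `(1/m)ℤ/ℤ` into primary components. The distribution relations eliminate every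
symbol having a coordinate that is neither zero nor a unit. On the remaining points there is one
family of relations per prime `l`: when `x l = 0`, the sum of the points obtained by putting each
unit in coordinate `l` equals `[Frob ^ e x] - [Frob ^ (e - 1) x]`, with `e` the exponent of `l` in
`m` (`ofLevel_toLevel`, `ofLevel_mem_rel`, `toLevel_mem_distRel`, `exists_sub_toLevel_mem`).

These families are imposed one prime at a time. A normal form (`rel_sup_normal`, `rel_inf_normal`)
shows that the operator of a new prime is injective on the span `P` of the points with `x l = 0`,
modulo the earlier relations. This gives an exact sequence `0 → P → A → A' → 0`, where `A` and `A'`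
are the quotients before and after. The points with `x l ≠ 0` contribute no cohomology
(`mem_bdy_of_proj_eq_zero`), because `c` moves all of them; here `-1 ≠ 1` in every component is
needed, that is, `m` not congruent to 2 mod 4. Hence `P ⊆ A` is an isomorphism on cohomology and all
translations act trivially there. The relation operator then induces zero: its sum over units lies
in the acyclic part and its two Frobenius terms cancel. The long exact sequence breaks up, and the
order for `A'` with sign `ε` is the product of the orders for `A` with signs `ε` and `-ε`
(`presIndex_insert`). With no relations the module is a permutation module with one fixed point, of
orders 2 and 1. The first prime gives 2 for both signs and every later prime squares the order,
whence `2 ^ 2 ^ (r - 1)`.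

For `O m`, an odd divisor `n > 1` provides a contracting homotopy: the `n`-torsion is `{0} ∪ H ∪
-H`, and the sum of its translations is zero (`tateIndex_rhoO_of_odd`). If `m` is a power of 2, the
relations amount to `[a + h] = -[a]` with `h` of order two. Then `c` permutes a basis up to sign,
fixing `[0]` and negating the class of a point `q` of order four; each sign of `ε` picks up one
factor `ℤ/2` (`tateIndex_rhoO_of_even`). -/

theorem map_applyAsHom_one (M : Rep k G) (j : G) :
    groupCohomology.map (MonoidHom.id G) (M.applyAsHom j) 1 = 𝟙 (groupCohomology M 1) := by
  rw [← cancel_epi (groupCohomology.H1π M), groupCohomology.H1π_comp_map, Category.comp_id]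
  refine ModuleCat.hom_ext (LinearMap.ext fun f => ?_)
  refine (groupCohomology.H1π_eq_iff _ _).2 ?_
  refine ⟨(f : G → M) j, ?_⟩
  have hf := (groupCohomology.mem_cocycles₁_iff f.1).1 f.2
  funext g
  have h1 := hf g j
  have h2 := hf j g
  rw [mul_comm, h1] at h2
  change M.ρ g (f.1 j) - f.1 j = M.ρ j (f.1 g) - f.1 g
  rw [sub_eq_sub_iff_add_eq_add, h2]

theorem map_applyAsHom_two (M : Rep k G) (j : G) :
    groupCohomology.map (MonoidHom.id G) (M.applyAsHom j) 2 = 𝟙 (groupCohomology M 2) := by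
  rw [← cancel_epi (groupCohomology.H2π M), groupCohomology.H2π_comp_map, Category.comp_id]
  refine ModuleCat.hom_ext (LinearMap.ext fun f => ?_)
  refine (groupCohomology.H2π_eq_iff _ _).2 ?_
  refine ⟨fun g => f.1 (j, g) - f.1 (g, j), ?_⟩
  have hf := (groupCohomology.mem_cocycles₂_def f.1).1 f.2
  funext ⟨g, h⟩
  have h1 := hf j g h
  have h2 := hf g j h
  have h3 := hf g h j
  change M.ρ g (f.1 (j, h) - f.1 (h, j)) - (f.1 (j, g * h) - f.1 (g * h, j)) +
    (f.1 (j, g) - f.1 (g, j)) = M.ρ j (f.1 (g, h)) - f.1 (g, h)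
  rw [mul_comm j g] at h1
  rw [mul_comm j h] at h2
  rw [map_sub, ← sub_eq_zero]
  -- Insert `j` in the three possible places of `(g, h)` and take the alternating sum of the
  -- resulting cocycle identities.
  have : M.ρ j (f.1 (g, h)) - f.1 (g * j, h) + f.1 (j, g * h) - f.1 (j, g) -
    (M.ρ g (f.1 (j, h)) - f.1 (g * j, h) + f.1 (g, h * j) - f.1 (g, j)) +
    (M.ρ g (f.1 (h, j)) - f.1 (g * h, j) + f.1 (g, h * j) - f.1 (g, h)) = 0 := by
    rw [h1, h2, h3]; simp
  rw [← neg_eq_zero, ← this]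
  abel

/-- The order of `ker (1 - ε c) / im (1 + ε c)`, for an endomorphism `c`. -/
noncomputable def tateIndex {A : Type*} [AddCommGroup A] (c : A →+ A) (ε : ℤ) : ℕ :=
  (AddMonoidHom.id A + ε • c).range.relIndex (AddMonoidHom.id A - ε • c).ker

theorem card_eq_relIndex {A H : Type*} [AddCommGroup A] [AddCommGroup H] {K B : AddSubgroup A}
    (f : K →+ H) (hf : Function.Surjective f) (h : ∀ x : K, f x = 0 ↔ (x : A) ∈ B) :
    Nat.card H = B.relIndex K := by
  rw [AddSubgroup.relIndex, AddSubgroup.index]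
  refine (Nat.card_congr ?_).symm
  have hk : B.addSubgroupOf K = f.ker := by
    ext x
    rw [AddSubgroup.mem_addSubgroupOf, AddMonoidHom.mem_ker]
    exact (h x).symm
  exact ((QuotientAddGroup.quotientAddEquivOfEq hk).trans
    (QuotientAddGroup.quotientKerEquivOfSurjective f hf)).toEquiv

theorem surjective_πOdd [Fintype G] (M : Rep k G) (g : G)
    (hg : ∀ x, x ∈ Subgroup.zpowers g) (i : ℕ) (hi : Odd i) :
    Function.Surjective (Rep.FiniteCyclicGroup.groupCohomologyπOdd M g hg i hi) :=
  (ModuleCat.epi_iff_surjective _).1 (epi_comp'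
    (@IsIso.epi_of_iso _ _ _ _ _ (Iso.isIso_inv _)) (epi_comp' inferInstance inferInstance))

theorem surjective_πEven [Fintype G] (M : Rep k G) (g : G)
    (hg : ∀ x, x ∈ Subgroup.zpowers g) (i : ℕ) [NeZero i] (hi : Even i) :
    Function.Surjective (Rep.FiniteCyclicGroup.groupCohomologyπEven M g hg i hi) :=
  (ModuleCat.epi_iff_surjective _).1 (epi_comp'
    (@IsIso.epi_of_iso _ _ _ _ _ (Iso.isIso_inv _)) (epi_comp' inferInstance inferInstance))

variable [Fintype G] (M : Rep k G) {g : G} (hg : ∀ x, x ∈ Subgroup.zpowers g)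
  (hu : ∀ x, x = 1 ∨ x = g) (h1 : g ≠ 1)

include hu h1 in
theorem norm_apply (x : M) : M.norm.hom x = x + M.ρ g x := by
  classical
  have hu : (Finset.univ : Finset G) = {1, g} := by
    ext y; simpa using hu y
  have : M.norm.hom x = ∑ g : G, M.ρ g x := by
    simp [Rep.norm, Representation.norm]
  rw [this, hu, Finset.sum_pair h1.symm, map_one]
  rfl

include hg hu h1

/-- For a cyclic group odd cohomology is the kernel of the norm modulo the image of `g - 1`. The
norm is `1 + g`, so this is the index with sign `-1`; the images of `g - 1` and `1 - g` agree. -/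
theorem card_groupCohomology_one :
    Nat.card (groupCohomology M 1) = tateIndex (M.ρ g : M →ₗ[k] M).toAddMonoidHom (-1) := by
  have key := card_eq_relIndex (A := M) (H := groupCohomology M 1)
    (B := (LinearMap.range (M.applyAsHom g - 𝟙 M).hom.toLinearMap).toAddSubgroup)
    (K := (LinearMap.ker M.norm.hom.toLinearMap).toAddSubgroup)
    (Rep.FiniteCyclicGroup.groupCohomologyπOdd M g hg 1 odd_one).hom.toAddMonoidHom
    (surjective_πOdd M g hg 1 odd_one)
    (Rep.FiniteCyclicGroup.groupCohomologyπOdd_eq_zero_iff M g hg 1 odd_one)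
  rw [key, tateIndex]
  congr 1
  · ext x
    constructor
    · rintro ⟨y, rfl⟩
      refine ⟨-y, ?_⟩
      simp [Rep.sub_hom, Rep.applyAsHom_apply]
      abel
    · rintro ⟨y, rfl⟩
      refine ⟨-y, ?_⟩
      simp [Rep.sub_hom, Rep.applyAsHom_apply]
      abel
  · ext x
    change M.norm.hom x = 0 ↔ _
    rw [norm_apply M hu h1, AddMonoidHom.mem_ker]
    simp

theorem card_groupCohomology_two :
    Nat.card (groupCohomology M 2) = tateIndex (M.ρ g : M →ₗ[k] M).toAddMonoidHom 1 := by
  have key := card_eq_relIndex (A := M) (H := groupCohomology M 2)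
    (K := (LinearMap.ker (M.applyAsHom g - 𝟙 M).hom.toLinearMap).toAddSubgroup)
    (B := (LinearMap.range M.norm.hom.toLinearMap).toAddSubgroup)
    (Rep.FiniteCyclicGroup.groupCohomologyπEven M g hg 2 even_two).hom.toAddMonoidHom
    (surjective_πEven M g hg 2 even_two)
    (Rep.FiniteCyclicGroup.groupCohomologyπEven_eq_zero_iff M g hg 2 even_two)
  rw [key, tateIndex]
  congr 1
  · ext x
    refine exists_congr fun y => ?_
    change M.norm.hom y = x ↔ _
    rw [norm_apply M hu h1]
    simp
  · ext x
    change (M.applyAsHom g - 𝟙 M).hom x = 0 ↔ _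
    rw [AddMonoidHom.mem_ker]
    simpa [Rep.sub_hom, Rep.applyAsHom_apply, sub_eq_zero] using eq_comm

/-- If `g y = -y` then `2 y = (g - 1)(-y)`; if `g y = y` then `2 y` is the norm of `y`. -/
theorem two_smul_groupCohomology {i : ℕ} (hi : i = 1 ∨ i = 2) (x : groupCohomology M i) :
    (2 : k) • x = 0 := by
  rcases hi with rfl | rfl
  · obtain ⟨y, rfl⟩ := surjective_πOdd M g hg 1 odd_one x
    rw [← map_smul]
    refine (Rep.FiniteCyclicGroup.groupCohomologyπOdd_eq_zero_iff M g hg 1 odd_one _).2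
      ⟨-y.1, ?_⟩
    have hy : M.norm.hom y.1 = 0 := y.2
    rw [norm_apply M hu h1] at hy
    have : M.ρ g y.1 = - y.1 := (neg_eq_of_add_eq_zero_right hy).symm
    simp [Rep.sub_hom, Rep.applyAsHom_apply, this, two_smul]
  · obtain ⟨y, rfl⟩ := surjective_πEven M g hg 2 even_two x
    rw [← map_smul]
    refine (Rep.FiniteCyclicGroup.groupCohomologyπEven_eq_zero_iff M g hg 2 even_two _).2
      ⟨y.1, ?_⟩
    have hy : (M.applyAsHom g - 𝟙 M).hom y.1 = 0 := y.2
    have : M.ρ g y.1 = y.1 := by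
      simpa [Rep.sub_hom, Rep.applyAsHom_apply, sub_eq_zero] using hy
    change M.norm.hom y.1 = _
    rw [norm_apply M hu h1, this]
    simp [two_smul]

end CyclicOrderTwo

/-! ### The group `J` and the shape of its cohomology -/

section CohomologyOfJ

theorem actsTriviallyOnCohomology {m : ℕ} (M : Rep ℤ (J m)) {i : ℕ} (hi : i = 1 ∨ i = 2) :
    ActsTriviallyOnCohomology M i := by
  intro j
  rcases hi with rfl | rfl
  · exact map_applyAsHom_one M j
  · exact map_applyAsHom_two M j

/-- The generator `c = σ_{-1}` of `J`. -/
def conj (m : ℕ) : J m := ⟨-1, Subgroup.mem_zpowers _⟩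

theorem mem_zpowers_conj {m : ℕ} (x : J m) : x ∈ Subgroup.zpowers (conj m) := by
  obtain ⟨x, hx⟩ := x
  obtain ⟨k, rfl⟩ := hx
  exact ⟨k, by ext; simp [conj]⟩

theorem eq_one_or_conj {m : ℕ} (x : J m) : x = 1 ∨ x = conj m := by
  obtain ⟨k, rfl⟩ := mem_zpowers_conj x
  have h : (conj m) ^ (2 : ℤ) = 1 := by
    apply Subtype.ext
    simp [conj]
  rcases Int.even_or_odd' k with ⟨l, rfl | rfl⟩
  · left; simp only [zpow_mul, h, one_zpow]
  · right; simp only [zpow_add, zpow_mul, h, one_zpow, one_mul, zpow_one]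

theorem conj_ne_one {m : ℕ} (hm : 2 < m) : conj m ≠ 1 := by
  intro h
  have : Fact (2 < m) := ⟨hm⟩
  have h1 : ((-1 : (ZMod m)ˣ) : ZMod m) = ((1 : (ZMod m)ˣ) : ZMod m) :=
    congrArg (fun x : J m => ((x : (ZMod m)ˣ) : ZMod m)) h
  simp only [Units.val_neg, Units.val_one] at h1
  exact ZMod.neg_one_ne_one h1

theorem nonempty_addEquiv_of_card {H : Type*} [AddCommGroup H] (h2 : ∀ x : H, 2 • x = 0) {k : ℕ}
    (hk : Nat.card H = 2 ^ k) : Nonempty (H ≃+ (Fin k → ZMod 2)) := by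
  have : Finite H := Nat.finite_of_card_ne_zero (by rw [hk]; positivity)
  let _ : Module (ZMod 2) H := AddCommGroup.zmodModule h2
  have h := Module.natCard_eq_pow_finrank (K := ZMod 2) (V := H)
  rw [hk, Nat.card_zmod] at h
  have hr : Module.finrank (ZMod 2) H = k := (Nat.pow_right_injective le_rfl h).symm
  exact ⟨(Module.finBasisOfFinrankEq (ZMod 2) H hr).equivFun.toAddEquiv⟩

theorem card_groupCohomology {m : ℕ} (hm : 2 < m) (M : Rep ℤ (J m)) {n : ℕ}
    (h : ∀ ε : ℤ, ε = 1 ∨ ε = -1 → tateIndex (M.ρ (conj m) : M →ₗ[ℤ] M).toAddMonoidHom ε = n)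
    {i : ℕ} (hi : i = 1 ∨ i = 2) : Nat.card (groupCohomology M i) = n := by
  have : NeZero m := ⟨by omega⟩
  have : Fintype (J m) := Fintype.ofFinite _
  rcases hi with rfl | rfl
  · rw [card_groupCohomology_one M mem_zpowers_conj eq_one_or_conj (conj_ne_one hm)]
    exact h _ (Or.inr rfl)
  · rw [card_groupCohomology_two M mem_zpowers_conj eq_one_or_conj (conj_ne_one hm)]
    exact h _ (Or.inl rfl)

theorem nonempty_groupCohomology_addEquiv {m : ℕ} (hm : 2 < m) (M : Rep ℤ (J m)) {n : ℕ}
    (h : ∀ ε : ℤ, ε = 1 ∨ ε = -1 →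
      tateIndex (M.ρ (conj m) : M →ₗ[ℤ] M).toAddMonoidHom ε = 2 ^ n)
    {i : ℕ} (hi : i = 1 ∨ i = 2) : Nonempty (groupCohomology M i ≃+ (Fin n → ZMod 2)) := by
  have : NeZero m := ⟨by omega⟩
  have : Fintype (J m) := Fintype.ofFinite _
  refine nonempty_addEquiv_of_card (fun x => ?_) (card_groupCohomology hm M h hi)
  have h2 := two_smul_groupCohomology M mem_zpowers_conj eq_one_or_conj (conj_ne_one hm) hi x
  rw [two_smul] at h2
  rw [two_nsmul, h2]

end CohomologyOfJ

/-! ### A presentation indexed by a product of groups with zero -/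

section Presentation

set_option linter.unusedSectionVars false

theorem lhom_ext_single {X B : Type*} [AddCommGroup B] [Module ℤ B] {f g : (X →₀ ℤ) →ₗ[ℤ] B}
    (h : ∀ x, f (Finsupp.single x 1) = g (Finsupp.single x 1)) : f = g :=
  Finsupp.lhom_ext' fun x => LinearMap.ext_ring (h x)

theorem supported_le_comap {X : Type*} {s s' : Set X} (f : (X →₀ ℤ) →ₗ[ℤ] (X →₀ ℤ))
    (h : ∀ x ∈ s, f (Finsupp.single x 1) ∈ Finsupp.supported ℤ ℤ s') :
    Finsupp.supported ℤ ℤ s ≤ (Finsupp.supported ℤ ℤ s').comap f := by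
  rw [Finsupp.supported_eq_span_single, Submodule.span_le]
  rintro _ ⟨x, hx, rfl⟩
  exact h x hx

variable {ι : Type} [DecidableEq ι] {G : ι → Type} [∀ i, CommGroup (G i)] [∀ i, Fintype (G i)]

/-- Points of the product of the groups with zero `{0} ∪ G i`. -/
abbrev Pt (G : ι → Type) : Type := ∀ i, WithZero (G i)

/-- The free abelian group on the points. -/
abbrev FreePt (G : ι → Type) : Type := Pt G →₀ ℤ

/-- Translation by `t`. -/
def tr (t : ∀ i, G i) (x : Pt G) : Pt G := fun i => (t i : WithZero (G i)) * x i

/-- The action of `∏ G i` on the free abelian group on the points. -/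
noncomputable def act (t : ∀ i, G i) : FreePt G →ₗ[ℤ] FreePt G :=
  Finsupp.linearCombination ℤ fun x => Finsupp.single (tr t x) 1

open Classical in
/-- The projection onto the span of the points with vanishing `i`-th coordinate. -/
noncomputable def proj (i : ι) : FreePt G →ₗ[ℤ] FreePt G :=
  Finsupp.linearCombination ℤ fun x => if x i = 0 then Finsupp.single x 1 else 0

/-- Replaces the `i`-th coordinate by the sum of all elements of `G i`. -/
noncomputable def fill (i : ι) : FreePt G →ₗ[ℤ] FreePt G :=
  Finsupp.linearCombination ℤ fun x =>
    ∑ g : G i, Finsupp.single (Function.update x i (g : WithZero (G i))) 1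

open Classical in
/-- Keeps the points with `i`-th coordinate `1`, and replaces that coordinate by `0`. -/
noncomputable def strip (i : ι) : FreePt G →ₗ[ℤ] FreePt G :=
  Finsupp.linearCombination ℤ fun x =>
    if x i = 1 then Finsupp.single (Function.update x i 0) 1 else 0

section Lemmas

variable (t s : ∀ i, G i) (i j : ι) (x : Pt G) (a : FreePt G)

theorem act_single : act t (Finsupp.single x 1) = Finsupp.single (tr t x) 1 := by
  simp [act]

open Classical in
theorem proj_single : proj i (Finsupp.single x 1) = if x i = 0 then Finsupp.single x 1 else 0 := by
  simp [proj]

theorem fill_single : fill i (Finsupp.single x 1) =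
    ∑ g : G i, Finsupp.single (Function.update x i (g : WithZero (G i))) 1 := by
  simp [fill]

open Classical in
theorem strip_single : strip i (Finsupp.single x 1) =
    if x i = 1 then Finsupp.single (Function.update x i 0) 1 else 0 := by
  simp [strip]

attribute [irreducible] act proj fill strip

theorem tr_eq_zero_iff : tr t x i = 0 ↔ x i = 0 := by
  simp [tr]

theorem tr_tr : tr t (tr s x) = tr (t * s) x := by
  funext i
  simp [tr, mul_assoc]

theorem tr_one : tr (1 : ∀ i, G i) x = x := by
  funext i
  simp [tr]

theorem tr_update (w : WithZero (G i)) :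
    tr t (Function.update x i w) = Function.update (tr t x) i (t i * w) := by
  funext j
  by_cases h : j = i
  · subst h; simp [tr]
  · simp [tr, h]

theorem act_act : act t (act s a) = act (t * s) a := by
  refine LinearMap.congr_fun (f := act t ∘ₗ act s) (lhom_ext_single fun x => ?_) a
  simp [act_single, tr_tr]

theorem act_one : act (1 : ∀ i, G i) a = a := by
  refine LinearMap.congr_fun (g := LinearMap.id) (lhom_ext_single fun x => ?_) a
  simp [act_single, tr_one]

theorem act_comm : act t (act s a) = act s (act t a) := by
  rw [act_act, act_act, mul_comm]

theorem coe_ne_one {i : ι} {g : G i} (hg : g ≠ 1) : (g : WithZero (G i)) ≠ 1 :=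
  fun h => hg (WithZero.coe_inj.1 h)

theorem proj_act : proj i (act t a) = act t (proj i a) := by
  have h : (proj i ∘ₗ act t : FreePt G →ₗ[ℤ] FreePt G) = act t ∘ₗ proj i := by
    refine lhom_ext_single fun x => ?_
    by_cases hx : x i = 0 <;> simp [act_single, proj_single, tr_eq_zero_iff, hx]
  exact LinearMap.congr_fun h a

theorem proj_proj : proj i (proj i a) = proj i a := by
  have h : (proj i ∘ₗ proj i : FreePt G →ₗ[ℤ] FreePt G) = proj i := by
    refine lhom_ext_single fun x => ?_
    simp only [LinearMap.comp_apply, proj_single]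
    split_ifs with h <;> simp [proj_single, h]
  exact LinearMap.congr_fun h a

theorem proj_comm : proj i (proj j a) = proj j (proj i a) := by
  have h : (proj i ∘ₗ proj j : FreePt G →ₗ[ℤ] FreePt G) = proj j ∘ₗ proj i := by
    refine lhom_ext_single fun x => ?_
    simp only [LinearMap.comp_apply, proj_single]
    split_ifs with h h' <;> simp [proj_single, *]
  exact LinearMap.congr_fun h a

theorem fill_act : fill i (act t a) = act t (fill i a) := by
  have h : (fill i ∘ₗ act t : FreePt G →ₗ[ℤ] FreePt G) = act t ∘ₗ fill i := by
    refine lhom_ext_single fun x => ?_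
    simp only [LinearMap.comp_apply, act_single, fill_single, map_sum, tr_update]
    refine (Fintype.sum_equiv (Equiv.mulLeft (t i)) _ _ fun g => ?_).symm
    simp
  exact LinearMap.congr_fun h a

theorem proj_fill_self : proj i (fill i a) = 0 := by
  have h : (proj i ∘ₗ fill i : FreePt G →ₗ[ℤ] FreePt G) = 0 := by
    refine lhom_ext_single fun x => ?_
    simp [fill_single, proj_single]
  exact LinearMap.congr_fun h a

/-- Exactly one of the points produced by `fill` from a given point has `i`-th coordinate `1`. Thus
`fill i` is injective on the image of `proj i`. -/
theorem strip_fill : strip i (fill i (proj i a)) = proj i a := by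
  have h : (strip i ∘ₗ fill i ∘ₗ proj i : FreePt G →ₗ[ℤ] FreePt G) = proj i := by
    refine lhom_ext_single fun x => ?_
    simp only [LinearMap.comp_apply, proj_single]
    split_ifs with h
    · rw [fill_single, map_sum]
      rw [Finset.sum_eq_single 1]
      · simp [strip_single, ← h]
      · intro g _ hg
        simp [strip_single, coe_ne_one hg]
      · simp
    · simp
  exact LinearMap.congr_fun h a

variable {i j} (hij : i ≠ j)
include hij

theorem proj_fill : proj i (fill j a) = fill j (proj i a) := by
  have h : (proj i ∘ₗ fill j : FreePt G →ₗ[ℤ] FreePt G) = fill j ∘ₗ proj i := by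
    refine lhom_ext_single fun x => ?_
    have hu : ∀ g : G j, Function.update x j (g : WithZero (G j)) i = x i :=
      fun g => Function.update_of_ne hij _ _
    by_cases hx : x i = 0 <;> simp [fill_single, proj_single, hu, hx]
  exact LinearMap.congr_fun h a

theorem fill_comm : fill i (fill j a) = fill j (fill i a) := by
  have h : (fill i ∘ₗ fill j : FreePt G →ₗ[ℤ] FreePt G) = fill j ∘ₗ fill i := by
    refine lhom_ext_single fun x => ?_
    simp only [LinearMap.comp_apply, fill_single, map_sum]
    rw [Finset.sum_comm]
    simp only [Function.update_comm hij]
  exact LinearMap.congr_fun h a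

end Lemmas

/-- The elements acting as the Frobenius powers in the relations. -/
structure Twist (G : ι → Type) [∀ i, CommGroup (G i)] where
  /-- the element acting with sign `-1` -/
  α : ι → ∀ i, G i
  /-- the element acting with sign `+1` -/
  β : ι → ∀ i, G i

variable (F : Twist G)

/-- The relation operator `[x] ↦ ∑ g, [x with i-th coordinate g] - [α i x] + [β i x]`, on points
with vanishing `i`-th coordinate; the other points are sent to `0`. -/
noncomputable def relOp (i : ι) : FreePt G →ₗ[ℤ] FreePt G :=
  (fill i - act (F.α i) + act (F.β i)) ∘ₗ proj i

theorem relOp_apply (i : ι) (a : FreePt G) :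
    relOp F i a = fill i (proj i a) - act (F.α i) (proj i a) + act (F.β i) (proj i a) := rfl

theorem relOp_act (i : ι) (t : ∀ i, G i) (a : FreePt G) :
    relOp F i (act t a) = act t (relOp F i a) := by
  simp only [relOp_apply, proj_act, fill_act, act_comm _ t, map_sub, map_add]

theorem relOp_proj_self (i : ι) (a : FreePt G) : relOp F i (proj i a) = relOp F i a := by
  simp only [relOp_apply, proj_proj]

theorem relOp_proj {i j : ι} (hij : i ≠ j) (a : FreePt G) :
    relOp F i (proj j a) = proj j (relOp F i a) := by
  simp only [relOp_apply, proj_act, proj_fill _ hij.symm, proj_comm j i, map_sub, map_add]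

theorem relOp_comm {i j : ι} (hij : i ≠ j) (a : FreePt G) :
    relOp F i (relOp F j a) = relOp F j (relOp F i a) := by
  rw [relOp_apply F j a, map_add, map_sub, relOp_act, relOp_act, relOp_apply F j (relOp F i a)]
  congr 2
  · rw [relOp_apply, relOp_apply, proj_fill _ hij, fill_comm _ hij]
    simp only [map_add, map_sub, proj_act, fill_act, proj_fill _ hij.symm, proj_comm j i]
  · rw [← relOp_proj F hij]
  · rw [← relOp_proj F hij]

/-- The two translates keep a zero `i`-th coordinate and the filled points have none, so removing
the zero-coordinate part isolates `fill`. All injectivity statements below rest on this separation.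
-/
theorem sub_proj_relOp (i : ι) (a : FreePt G) :
    relOp F i a - proj i (relOp F i a) = fill i (proj i a) := by
  simp only [relOp_apply, map_add, map_sub, proj_fill_self, proj_act, proj_proj]
  abel

/-- The span of the relations attached to the indices in `S`. -/
noncomputable def rel (S : Finset ι) : Submodule ℤ (FreePt G) :=
  ⨆ i ∈ S, LinearMap.range (relOp F i)

theorem relOp_mem_rel {S : Finset ι} {i : ι} (hi : i ∈ S) (a : FreePt G) : relOp F i a ∈ rel F S :=
  (le_iSup₂_of_le (f := fun i (_ : i ∈ S) => LinearMap.range (relOp F i)) i hi le_rfl) ⟨a, rfl⟩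

theorem rel_le_comap {S : Finset ι} (f : FreePt G →ₗ[ℤ] FreePt G)
    (hf : ∀ i ∈ S, ∀ a, f (relOp F i a) = relOp F i (f a)) : rel F S ≤ (rel F S).comap f := by
  refine iSup₂_le fun i hi => ?_
  rintro _ ⟨a, rfl⟩
  rw [Submodule.mem_comap, hf i hi]
  exact relOp_mem_rel F hi _

theorem act_mem_rel {S : Finset ι} (t : ∀ i, G i) {a : FreePt G} (ha : a ∈ rel F S) :
    act t a ∈ rel F S :=
  rel_le_comap F (act t) (fun i _ a => (relOp_act F i t a).symm) ha

theorem proj_mem_rel {S : Finset ι} {i : ι} (hi : i ∉ S) {a : FreePt G} (ha : a ∈ rel F S) :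
    proj i a ∈ rel F S :=
  rel_le_comap F (proj i)
    (fun _ hj a => (relOp_proj F (ne_of_mem_of_not_mem hj hi) a).symm) ha

theorem relOp_mem_rel_of_mem {S : Finset ι} {i : ι} (hi : i ∉ S) {a : FreePt G}
    (ha : a ∈ rel F S) : relOp F i a ∈ rel F S :=
  rel_le_comap F (relOp F i)
    (fun _ hj a => relOp_comm F (ne_of_mem_of_not_mem hj hi).symm a) ha

theorem rel_insert (S : Finset ι) (i : ι) :
    rel F (insert i S) = rel F S ⊔ LinearMap.range (relOp F i) := by
  rw [rel, Finset.iSup_insert, sup_comm, rel]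

theorem rel_empty : rel F ∅ = ⊥ := by
  simp [rel]

theorem rel_mono {S T : Finset ι} (h : S ⊆ T) : rel F S ≤ rel F T :=
  iSup₂_le fun _ hi => by
    rintro _ ⟨a, rfl⟩
    exact relOp_mem_rel F (h hi) a

/-- The span of the points in normal form with respect to the relations attached to `S`. -/
noncomputable def normal (S : Finset ι) : Submodule ℤ (FreePt G) :=
  Finsupp.supported ℤ ℤ {x | ∀ i ∈ S, x i ≠ 1}

theorem single_mem_normal {S : Finset ι} {x : Pt G} (h : ∀ i ∈ S, x i ≠ 1) :
    Finsupp.single x 1 ∈ normal S :=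
  Finsupp.single_mem_supported ℤ 1 h

theorem proj_mem_normal {S : Finset ι} (i : ι) {a : FreePt G} (ha : a ∈ normal S) :
    proj i a ∈ normal (insert i S) := by
  refine supported_le_comap (proj i) (fun x hx => ?_) ha
  rw [proj_single]
  split_ifs with h
  · refine single_mem_normal fun j hj => ?_
    rcases Finset.mem_insert.1 hj with rfl | hj
    · simp [h]
    · exact hx j hj
  · exact zero_mem _

theorem normal_anti {S T : Finset ι} (h : S ⊆ T) : (normal T : Submodule ℤ (FreePt G)) ≤ normal S :=
  Finsupp.supported_mono fun _ hx i hi => hx i (h hi)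

theorem fill_mem_normal {S : Finset ι} {i : ι} (hi : i ∉ S) {a : FreePt G} (ha : a ∈ normal S) :
    fill i a ∈ normal S := by
  refine supported_le_comap (fill i) (fun x hx => ?_) ha
  rw [fill_single]
  refine sum_mem fun g _ => single_mem_normal fun j hj => ?_
  rw [Function.update_of_ne (ne_of_mem_of_not_mem hj hi)]
  exact hx j hj

theorem strip_eq_zero {S : Finset ι} {i : ι} {a : FreePt G} (ha : a ∈ normal (insert i S)) :
    strip i a = 0 := by
  have := supported_le_comap (s' := ∅) (strip i) (fun x hx => ?_) ha
  · simpa using this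
  · rw [strip_single, if_neg (hx i (Finset.mem_insert_self i S))]
    exact zero_mem _

/-- A relation can be solved for its point with `i`-th coordinate `1`; the other terms have a
coordinate different from `0` and `1`, or a zero one, and the latter are handled by projecting the
induction hypothesis. -/
theorem rel_sup_normal (S : Finset ι) : rel F S ⊔ normal S = ⊤ := by
  induction S using Finset.induction_on with
  | empty =>
    rw [eq_top_iff]
    refine le_sup_of_le_right ?_
    simp [normal]
  | insert i S hi ih =>
    have hproj : ∀ a : FreePt G, proj i a ∈ rel F (insert i S) ⊔ normal (insert i S) := by
      intro a
      have ha : a ∈ rel F S ⊔ normal S := ih ▸ Submodule.mem_top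
      obtain ⟨r, hr, n, hn, rfl⟩ := Submodule.mem_sup.1 ha
      rw [map_add]
      exact Submodule.add_mem_sup (rel_mono F (Finset.subset_insert i S) (proj_mem_rel F hi hr))
        (proj_mem_normal i hn)
    have hle : normal S ≤ rel F (insert i S) ⊔ normal (insert i S) := by
      rw [normal, Finsupp.supported_eq_span_single, Submodule.span_le]
      rintro _ ⟨x, hx, rfl⟩
      change Finsupp.single x 1 ∈ _
      by_cases hxi : x i = 1
      · set y := Function.update x i 0 with hy
        have hy0 : proj i (Finsupp.single y (1 : ℤ)) = Finsupp.single y 1 := by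
          rw [proj_single, if_pos (by simp [hy])]
        have h1 := relOp_apply F i (Finsupp.single y 1)
        have hy1 : ∀ g : G i, Function.update y i (g : WithZero (G i)) = Function.update x i g :=
          fun g => by simp [hy]
        classical
        rw [hy0, fill_single, Fintype.sum_eq_add_sum_compl 1] at h1
        simp only [hy1] at h1
        have hx1 : Function.update x i ((1 : G i) : WithZero (G i)) = x := by
          rw [WithZero.coe_one, ← hxi, Function.update_eq_self]
        rw [hx1] at h1
        have h2 : Finsupp.single x (1 : ℤ) = relOp F i (Finsupp.single y 1)
            - ∑ g ∈ ({1}ᶜ : Finset (G i)), Finsupp.single (Function.update x i (g : WithZero (G i))) 1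
            + proj i (act (F.α i) (Finsupp.single y 1))
            - proj i (act (F.β i) (Finsupp.single y 1)) := by
          rw [h1, proj_act, proj_act, hy0]
          abel
        rw [h2]
        refine sub_mem (add_mem (sub_mem (Submodule.mem_sup_left
          (relOp_mem_rel F (Finset.mem_insert_self i S) _)) (Submodule.mem_sup_right
          (sum_mem fun g hg => single_mem_normal fun j hj => ?_))) (hproj _)) (hproj _)
        by_cases hji : j = i
        · subst hji
          simpa using coe_ne_one (by simpa using hg)
        · rw [Function.update_of_ne hji]
          exact hx j ((Finset.mem_insert.1 hj).resolve_left hji)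
      · refine Submodule.mem_sup_right (single_mem_normal fun j hj => ?_)
        rcases Finset.mem_insert.1 hj with rfl | hj
        · exact hxi
        · exact hx j hj
    rw [eq_top_iff, ← ih]
    exact sup_le (le_sup_of_le_left (rel_mono F (Finset.subset_insert i S))) hle

/-- Together with `rel_sup_normal` this makes the points without coordinate `1` in `S` a basis of
the quotient. The part of `z` that matters is first made normal for `S`; comparing nonzero `i`-th
coordinates then gives an identity inside `rel F S ⊓ normal S`, and `strip` shows that this part
vanishes. -/
theorem rel_inf_normal (S : Finset ι) : rel F S ⊓ normal S = ⊥ := by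
  induction S using Finset.induction_on with
  | empty => rw [rel_empty, bot_inf_eq]
  | insert i S hi ih =>
    rw [eq_bot_iff]
    rintro a ⟨ha, hn⟩
    rw [SetLike.mem_coe, rel_insert] at ha
    obtain ⟨r, hr, _, ⟨z, rfl⟩, hrz⟩ := Submodule.mem_sup.1 ha
    have h : proj i z ∈ rel F S ⊔ normal S := rel_sup_normal F S ▸ Submodule.mem_top
    obtain ⟨s, hs, n, hn', hsn⟩ := Submodule.mem_sup.1 h
    set r' := r + relOp F i s with hr'
    have hr'S : r' ∈ rel F S := add_mem hr (relOp_mem_rel_of_mem F hi hs)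
    have hrn : r' + relOp F i n = a := by
      rw [← hrz, ← relOp_proj_self F i z, ← hsn, map_add, hr', add_assoc]
    have hnS : a ∈ normal S := normal_anti (Finset.subset_insert i S) hn
    have hfn : fill i (proj i n) ∈ normal S :=
      fill_mem_normal hi (normal_anti (Finset.subset_insert i S) (proj_mem_normal i hn'))
    have h1 : r' - proj i r' = a - proj i a - fill i (proj i n) := by
      have hn1 : relOp F i n = a - r' := by rw [← hrn, add_sub_cancel_left]
      rw [← sub_proj_relOp F, hn1, map_sub]
      abel
    have h2 : r' - proj i r' = 0 := by
      have : r' - proj i r' ∈ rel F S ⊓ normal S := by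
        refine ⟨sub_mem hr'S (proj_mem_rel F hi hr'S), ?_⟩
        rw [h1]
        exact sub_mem (sub_mem hnS (normal_anti (Finset.subset_insert i S)
          (proj_mem_normal i hnS))) hfn
      rwa [ih, Submodule.mem_bot] at this
    have h3 : proj i n = 0 := by
      have hf : fill i (proj i n) = a - proj i a := (sub_eq_zero.1 (h1.symm.trans h2)).symm
      rw [← strip_fill, hf, map_sub, strip_eq_zero hn,
        strip_eq_zero (proj_mem_normal i hnS), sub_zero]
    have h4 : relOp F i n = 0 := by rw [← relOp_proj_self, h3, map_zero]
    rw [h4, add_zero] at hrn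
    rw [← ih]
    exact ⟨hrn ▸ hr'S, hnS⟩

/-- Injectivity of the relation operator modulo the earlier relations, the left end of the exact
sequence. For a normal `n`, the part of `relOp F i n` with nonzero `i`-th coordinate is `fill i
(proj i n)`, which is again normal. -/
theorem proj_mem_rel_of_relOp_mem_rel {S : Finset ι} {i : ι} (hi : i ∉ S) {a : FreePt G}
    (ha : relOp F i a ∈ rel F S) : proj i a ∈ rel F S := by
  have h : proj i a ∈ rel F S ⊔ normal S := rel_sup_normal F S ▸ Submodule.mem_top
  obtain ⟨r, hr, n, hn, hrn⟩ := Submodule.mem_sup.1 h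
  have hpn : proj i r + proj i n = proj i a := by rw [← map_add, hrn, proj_proj]
  have h1 : relOp F i n ∈ rel F S := by
    have : relOp F i n = relOp F i a - relOp F i r := by
      rw [← relOp_proj_self F i a, ← hrn, map_add, add_sub_cancel_left]
    rw [this]
    exact sub_mem ha (relOp_mem_rel_of_mem F hi hr)
  have h2 : fill i (proj i n) = 0 := by
    have : fill i (proj i n) ∈ rel F S ⊓ normal S := by
      refine ⟨?_, fill_mem_normal hi (normal_anti (Finset.subset_insert i S) (proj_mem_normal i hn))⟩
      rw [← sub_proj_relOp F]
      exact sub_mem h1 (proj_mem_rel F hi h1)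
    rwa [rel_inf_normal, Submodule.mem_bot] at this
  have h3 : proj i n = 0 := by rw [← strip_fill, h2, map_zero]
  rw [← hpn, h3, add_zero]
  exact proj_mem_rel F hi hr

end Presentation

/-! ### Cycles and boundaries of an involution modulo the relations -/

section TateCohomology

set_option linter.unusedSectionVars false

/-- A choice of representatives of the free orbits of an involution. -/
theorem exists_half {X : Type*} (σ : X → X) (hσ : ∀ x, σ (σ x) = x) :
    ∃ H : Set X, (∀ x, σ x = x → x ∉ H) ∧ ∀ x, σ x ≠ x → (x ∈ H ↔ σ x ∉ H) := by
  refine ⟨{x | WellOrderingRel x (σ x)}, fun x hx h => ?_, fun x hx => ?_⟩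
  · rw [Set.mem_ofPred_eq, hx] at h
    exact irrefl_of _ x h
  · simp only [Set.mem_ofPred_eq, hσ]
    constructor
    · intro h h'
      exact asymm_of _ h h'
    · intro h
      rcases trichotomous_of WellOrderingRel x (σ x) with h1 | h1 | h1
      · exact h1
      · exact absurd h1.symm hx
      · exact absurd h1 h

/-- Every element is the sum of its part supported at the fixed points and of `k a + c (k (c a))`. -/
theorem exists_half_decomposition {X : Type*} (σ : X → X) (hσ : ∀ x, σ (σ x) = x)
    (c : (X →₀ ℤ) →ₗ[ℤ] (X →₀ ℤ)) (hc : ∀ x, c (Finsupp.single x 1) = Finsupp.single (σ x) 1) :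
    ∃ f k : (X →₀ ℤ) →ₗ[ℤ] (X →₀ ℤ),
      (∀ x, σ x = x → f (Finsupp.single x 1) = Finsupp.single x 1) ∧
      (∀ x, σ x ≠ x → f (Finsupp.single x 1) = 0) ∧ ∀ a, a = f a + k a + c (k (c a)) := by
  classical
  obtain ⟨H, hH, hH'⟩ := exists_half σ hσ
  set f := Finsupp.linearCombination ℤ
    (fun x => if σ x = x then Finsupp.single x (1 : ℤ) else 0) with hf
  set k := Finsupp.linearCombination ℤ
    (fun x => if x ∈ H then Finsupp.single x (1 : ℤ) else 0) with hk
  refine ⟨f, k, fun x hx => by simp [hf, hx], fun x hx => by simp [hf, hx], fun a => ?_⟩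
  have h : (LinearMap.id : (X →₀ ℤ) →ₗ[ℤ] (X →₀ ℤ)) = f + k + c ∘ₗ k ∘ₗ c := by
    refine lhom_ext_single fun x => ?_
    simp only [LinearMap.add_apply, LinearMap.comp_apply, hf, hk, hc, LinearMap.id_apply,
      Finsupp.linearCombination_single, one_smul]
    by_cases hx : σ x = x
    · simp [hx, hH x hx]
    · by_cases hxH : x ∈ H
      · simp [hx, hxH, (hH' x hx).1 hxH]
      · have : σ x ∈ H := by
          by_contra h
          exact hxH ((hH' x hx).2 h)
        simp [hx, hxH, this, hc, hσ]
  exact LinearMap.congr_fun h a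

variable {ι : Type} [DecidableEq ι] {G : ι → Type} [∀ i, CommGroup (G i)] [∀ i, Fintype (G i)]
  (F : Twist G) (c : ∀ i, G i)

/-- The elements `a` with `a = ε c a` modulo the relations attached to `S`. -/
noncomputable def cyc (S : Finset ι) (ε : ℤ) : Submodule ℤ (FreePt G) :=
  (rel F S).comap (LinearMap.id - ε • act c)

/-- The elements of the form `a + ε c a` modulo the relations attached to `S`. -/
noncomputable def bdy (S : Finset ι) (ε : ℤ) : Submodule ℤ (FreePt G) :=
  rel F S ⊔ LinearMap.range (LinearMap.id + ε • act c)

theorem mem_cyc {S : Finset ι} {ε : ℤ} {a : FreePt G} :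
    a ∈ cyc F c S ε ↔ a - ε • act c a ∈ rel F S := Iff.rfl

theorem mem_bdy {S : Finset ι} {ε : ℤ} {a : FreePt G} :
    a ∈ bdy F c S ε ↔ ∃ y, a - (y + ε • act c y) ∈ rel F S := by
  rw [bdy, Submodule.mem_sup]
  constructor
  · rintro ⟨r, hr, _, ⟨y, rfl⟩, rfl⟩
    refine ⟨y, ?_⟩
    simpa using hr
  · rintro ⟨y, hy⟩
    refine ⟨_, hy, _, ⟨y, rfl⟩, ?_⟩
    simp

theorem rel_le_bdy (S : Finset ι) (ε : ℤ) : rel F S ≤ bdy F c S ε := le_sup_left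

theorem bdy_mono {S T : Finset ι} (h : S ⊆ T) (ε : ℤ) : bdy F c S ε ≤ bdy F c T ε :=
  sup_le_sup_right (rel_mono F h) _

theorem cyc_mono {S T : Finset ι} (h : S ⊆ T) (ε : ℤ) : cyc F c S ε ≤ cyc F c T ε :=
  Submodule.comap_mono (rel_mono F h)

theorem map_mem_cyc {S : Finset ι} {ε : ℤ} (f : FreePt G →ₗ[ℤ] FreePt G)
    (hf : ∀ a ∈ rel F S, f a ∈ rel F S) (hfc : ∀ a, f (act c a) = act c (f a)) {a : FreePt G}
    (ha : a ∈ cyc F c S ε) : f a ∈ cyc F c S ε := by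
  rw [mem_cyc] at ha ⊢
  have := hf _ ha
  rwa [map_sub, map_zsmul, hfc] at this

theorem map_mem_bdy {S : Finset ι} {ε : ℤ} (f : FreePt G →ₗ[ℤ] FreePt G)
    (hf : ∀ a ∈ rel F S, f a ∈ rel F S) (hfc : ∀ a, f (act c a) = act c (f a)) {a : FreePt G}
    (ha : a ∈ bdy F c S ε) : f a ∈ bdy F c S ε := by
  rw [mem_bdy] at ha ⊢
  obtain ⟨y, hy⟩ := ha
  refine ⟨f y, ?_⟩
  have := hf _ hy
  rwa [map_sub, map_add, map_zsmul, hfc] at this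

theorem act_mem_cyc {S : Finset ι} {ε : ℤ} (t : ∀ i, G i) {a : FreePt G}
    (ha : a ∈ cyc F c S ε) : act t a ∈ cyc F c S ε :=
  map_mem_cyc F c (act t) (fun _ h => act_mem_rel F t h) (fun a => act_comm t c a) ha

theorem act_mem_bdy {S : Finset ι} {ε : ℤ} (t : ∀ i, G i) {a : FreePt G}
    (ha : a ∈ bdy F c S ε) : act t a ∈ bdy F c S ε :=
  map_mem_bdy F c (act t) (fun _ h => act_mem_rel F t h) (fun a => act_comm t c a) ha

theorem proj_mem_cyc {S : Finset ι} {ε : ℤ} {i : ι} (hi : i ∉ S) {a : FreePt G}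
    (ha : a ∈ cyc F c S ε) : proj i a ∈ cyc F c S ε :=
  map_mem_cyc F c (proj i) (fun _ h => proj_mem_rel F hi h) (fun a => proj_act c i a) ha

variable (hc : ∀ i, c i * c i = 1) (hc1 : ∀ i, c i ≠ 1)
include hc

theorem tr_invol (x : Pt G) : tr c (tr c x) = x := by
  rw [tr_tr, show c * c = 1 from funext hc, tr_one]

theorem act_invol (a : FreePt G) : act c (act c a) = a := by
  rw [act_act, show c * c = 1 from funext hc, act_one]

theorem smul_act_invol {ε : ℤ} (hε : ε * ε = 1) (a : FreePt G) :
    ε • act c (ε • act c a) = a := by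
  rw [map_zsmul, act_invol c hc, smul_smul, hε, one_smul]

theorem bdy_le_cyc (S : Finset ι) {ε : ℤ} (hε : ε * ε = 1) : bdy F c S ε ≤ cyc F c S ε := by
  intro a ha
  obtain ⟨y, hy⟩ := (mem_bdy F c).1 ha
  rw [mem_cyc]
  have h := sub_mem hy ((rel F S).smul_mem ε (act_mem_rel F c hy))
  have h2 := smul_act_invol c hc hε y
  convert h using 1
  rw [map_sub, map_add, smul_sub, smul_add, h2]
  abel

include hc1

theorem tr_eq_self_iff (x : Pt G) : tr c x = x ↔ x = 0 := by
  constructor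
  · intro h
    funext i
    by_contra hx
    obtain ⟨g, hg⟩ := WithZero.ne_zero_iff_exists.1 hx
    have := congrFun h i
    rw [tr, ← hg, ← WithZero.coe_mul, WithZero.coe_inj] at this
    exact hc1 i (mul_eq_right.1 this)
  · rintro rfl
    funext i
    simp [tr]

/-- The points with nonvanishing `i`-th coordinate span a cohomologically trivial module, also
modulo relations not involving `i`. -/
theorem mem_bdy_of_proj_eq_zero (S : Finset ι) : ∀ {ε : ℤ}, ε * ε = 1 → ∀ {i : ι}, i ∉ S →
    ∀ {a : FreePt G}, proj i a = 0 → a ∈ cyc F c S ε → a ∈ bdy F c S ε := by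
  classical
  induction S using Finset.induction_on with
  | empty =>
    intro ε hε i _ a hp ha
    rw [mem_cyc, rel_empty, Submodule.mem_bot, sub_eq_zero] at ha
    obtain ⟨f, k, -, hf, hk⟩ := exists_half_decomposition (tr c) (tr_invol c hc) (act c)
      (fun x => act_single c x)
    have hfp : f = f ∘ₗ proj i := by
      refine lhom_ext_single fun x => ?_
      rw [LinearMap.comp_apply, proj_single]
      split_ifs with hx
      · rfl
      · have : ¬ tr c x = x := fun h => hx (by rw [(tr_eq_self_iff c hc hc1 x).1 h]; rfl)
        rw [hf x this, map_zero]
    have hfa : f a = 0 := by rw [hfp, LinearMap.comp_apply, hp, map_zero]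
    have hca : act c a = ε • a := by
      conv_lhs => rw [ha, map_zsmul, act_invol c hc]
    -- Since `c a = ε a`, the decomposition reads `a = k a + ε c (k a)`.
    refine (mem_bdy F c).2 ⟨k a, ?_⟩
    have h := hk a
    rw [hfa, zero_add, hca, map_zsmul, map_zsmul] at h
    rw [← h, sub_self]
    exact zero_mem _
  | insert j S hj ih =>
    intro ε hε i hi a hp ha
    have hij : j ≠ i := fun h => hi (h ▸ Finset.mem_insert_self j S)
    have hiS : i ∉ S := fun h => hi (Finset.mem_insert_of_mem h)
    rw [mem_cyc, rel_insert] at ha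
    obtain ⟨r, hr, _, ⟨z, rfl⟩, hrz⟩ := Submodule.mem_sup.1 ha
    -- Discard from `r` and `z` all points with zero `i`-th coordinate, so that the induction
    -- hypothesis will apply to `z1`.
    set r1 := r - proj i r with hr1
    have hr1S : r1 ∈ rel F S := sub_mem hr (proj_mem_rel F hiS hr)
    set z1 := proj j (z - proj i z) with hz1
    have hz1j : proj j z1 = z1 := proj_proj _ _
    have hz1i : proj i z1 = 0 := by
      rw [hz1, proj_comm, map_sub, proj_proj, sub_self, map_zero]
    have h1 : r1 + relOp F j z1 = a - ε • act c a := by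
      have h2 : proj i (a - ε • act c a) = 0 := by
        rw [map_sub, map_zsmul, proj_act, hp, map_zero, smul_zero, sub_zero]
      rw [← hrz, map_add, ← relOp_proj F hij] at h2
      rw [hz1, relOp_proj_self, map_sub, ← hrz, hr1, ← sub_zero (r + _), ← h2]
      abel
    -- Applying `1 + ε c` kills `a - ε c a`; injectivity of the relation operator then makes `z1` a
    -- cycle for the opposite sign. This is why the induction runs over both signs.
    have h3 : z1 ∈ cyc F c S (-ε) := by
      rw [mem_cyc, neg_smul, sub_neg_eq_add]
      have h4 : proj j (z1 + ε • act c z1) = z1 + ε • act c z1 := by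
        rw [map_add, map_zsmul, proj_act, hz1j]
      rw [← h4]
      refine proj_mem_rel_of_relOp_mem_rel F hj ?_
      have h5 : relOp F j (z1 + ε • act c z1) = - (r1 + ε • act c r1) := by
        have h6 := congrArg (fun v => v + ε • act c v) h1
        simp only [map_add, smul_add, map_sub, smul_sub, smul_act_invol c hc hε] at h6
        rw [map_add, map_zsmul, relOp_act, ← sub_eq_zero, sub_neg_eq_add]
        rw [← sub_eq_zero] at h6
        rw [← h6]
        abel
      rw [h5]
      exact neg_mem (add_mem hr1S ((rel F S).smul_mem ε (act_mem_rel F c hr1S)))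
    obtain ⟨y, hy⟩ := (mem_bdy F c).1 (ih (by simpa using hε) hiS hz1i h3)
    set y1 := y - proj i y with hy1
    have hy1S : z1 - (y1 - ε • act c y1) ∈ rel F S := by
      have := sub_mem hy (proj_mem_rel F hiS hy)
      convert this using 1
      simp only [map_sub, map_add, hz1i, hy1, map_zsmul, proj_act, neg_smul, smul_sub,
        map_neg]
      abel
    -- With `z1 = y1 - ε c y1` modulo `rel F S`, subtracting `relOp F j y1` removes the obstruction
    -- to `a` being a cycle before the relations at `j`.
    have hcyc : a - relOp F j y1 ∈ cyc F c S ε := by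
      rw [mem_cyc]
      have h7 := add_mem hr1S (relOp_mem_rel_of_mem F hj hy1S)
      convert h7 using 1
      rw [map_sub (relOp F j) z1, ← add_sub_assoc, h1]
      simp only [map_sub, map_zsmul, relOp_act, smul_sub]
      abel
    have hpi : proj i (a - relOp F j y1) = 0 := by
      rw [map_sub, hp, ← relOp_proj F hij, hy1, map_sub, proj_proj, sub_self, map_zero, sub_zero]
    have h8 := add_mem (bdy_mono F c (Finset.subset_insert j S) ε (ih hε hiS hpi hcyc))
      (rel_le_bdy F c (insert j S) ε (relOp_mem_rel F (Finset.mem_insert_self j S) y1))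
    rwa [sub_add_cancel] at h8

theorem sub_proj_mem_bdy {S : Finset ι} {ε : ℤ} (hε : ε * ε = 1) {i : ι} (hi : i ∉ S)
    {a : FreePt G} (ha : a ∈ cyc F c S ε) : a - proj i a ∈ bdy F c S ε :=
  mem_bdy_of_proj_eq_zero F c hc hc1 S hε hi (by rw [map_sub, proj_proj, sub_self])
    (sub_mem ha (proj_mem_cyc F c hi ha))

theorem act_eq_self_of_forall_ne (i : ι) (t : ∀ i, G i) (ht : ∀ j ≠ i, t j = 1) (a : FreePt G) :
    act t (proj i a) = proj i a := by
  have h : (act t ∘ₗ proj i : FreePt G →ₗ[ℤ] FreePt G) = proj i := by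
    refine lhom_ext_single fun x => ?_
    rw [LinearMap.comp_apply, proj_single]
    split_ifs with hx
    · rw [act_single]
      congr 1
      funext j
      by_cases h : j = i
      · subst h; simp [tr, hx]
      · simp [tr, ht j h]
    · exact map_zero _
  exact LinearMap.congr_fun h a

/-- An element concentrated at `i` fixes all points with zero `i`-th coordinate, so `t a - a` lies
in the acyclic part. When `i ∈ S`, it also fixes the relations at `i`, and `t a - a` is already a
cycle modulo the other relations. -/
theorem act_sub_mem_bdy_of_forall_ne {S : Finset ι} {ε : ℤ} (hε : ε * ε = 1) (i : ι)
    (t : ∀ i, G i) (ht : ∀ j ≠ i, t j = 1) {a : FreePt G} (ha : a ∈ cyc F c S ε) :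
    act t a - a ∈ bdy F c S ε := by
  have htp := act_eq_self_of_forall_ne c hc hc1 i t ht
  by_cases hi : i ∈ S
  · obtain ⟨S, hiS, rfl⟩ : ∃ S', i ∉ S' ∧ S = insert i S' :=
      ⟨S.erase i, Finset.notMem_erase i S, (Finset.insert_erase hi).symm⟩
    rw [mem_cyc, rel_insert] at ha
    obtain ⟨r, hr, _, ⟨z, rfl⟩, hrz⟩ := Submodule.mem_sup.1 ha
    refine bdy_mono F c (Finset.subset_insert i S) ε
      (mem_bdy_of_proj_eq_zero F c hc hc1 S hε hiS ?_ ?_)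
    · rw [map_sub, proj_act, htp, sub_self]
    · rw [mem_cyc]
      have h := sub_mem (act_mem_rel F t hr) hr
      convert h using 1
      have h2 : act t (relOp F i z) = relOp F i z := by
        rw [← relOp_act, ← relOp_proj_self, proj_act, htp, relOp_proj_self]
      have h3 : r = a - ε • act c a - relOp F i z := by rw [← hrz, add_sub_cancel_right]
      rw [h3]
      simp only [map_sub, map_zsmul, h2, act_comm t c, smul_sub]
      abel
  · have h := sub_proj_mem_bdy F c hc hc1 hε hi ha
    have h2 := sub_mem (act_mem_bdy F c t h) h
    convert h2 using 1
    rw [map_sub, htp]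
    abel

variable [Fintype ι]

/-- Translations act trivially on cohomology: factor `t` into its components. -/
theorem act_sub_mem_bdy {S : Finset ι} {ε : ℤ} (hε : ε * ε = 1) (t : ∀ i, G i) {a : FreePt G}
    (ha : a ∈ cyc F c S ε) : act t a - a ∈ bdy F c S ε := by
  suffices h : ∀ (T : Finset ι) (t : ∀ i, G i), (∀ i ∉ T, t i = 1) →
      act t a - a ∈ bdy F c S ε from h Finset.univ t (by simp)
  intro T
  induction T using Finset.induction_on with
  | empty =>
    intro t ht
    have : t = 1 := funext fun i => ht i (by simp)
    rw [this, act_one, sub_self]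
    exact zero_mem _
  | insert i T hi ih =>
    intro t ht
    have h1 := ih (Function.update t i 1) fun j hj => by
      by_cases hji : j = i
      · subst hji; simp
      · rw [Function.update_of_ne hji]
        exact ht j (by simp [hji, hj])
    have h2 := act_sub_mem_bdy_of_forall_ne F c hc hc1 hε i (Pi.mulSingle i (t i))
      (fun j hj => by simp [hj]) (act_mem_cyc F c (Function.update t i 1) ha)
    have h3 : Pi.mulSingle i (t i) * Function.update t i 1 = t := by
      funext j
      by_cases hji : j = i
      · subst hji; simp
      · simp [hji]
    rw [act_act, h3] at h2
    simpa using add_mem h2 h1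

end TateCohomology

/-! ### The order of the cohomology of the presented module -/

section TateIndex

set_option linter.unusedSectionVars false

variable {ι : Type} [DecidableEq ι] {G : ι → Type} [∀ i, CommGroup (G i)] [∀ i, Fintype (G i)]
  (F : Twist G) (c : ∀ i, G i)

/-- The index of `bdy` in `cyc`. -/
noncomputable def presIndex (S : Finset ι) (ε : ℤ) : ℕ :=
  (bdy F c S ε).toAddSubgroup.relIndex (cyc F c S ε).toAddSubgroup

variable (hc : ∀ i, c i * c i = 1) (hc1 : ∀ i, c i ≠ 1) [Fintype ι]
include hc hc1

/-- The relation operator is zero on cohomology: `fill` lands in the acyclic part, and the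
translates by `α` and `β` have equal classes and opposite signs. -/
theorem relOp_mem_bdy_of_mem_cyc {S : Finset ι} {ε : ℤ} (hε : ε * ε = 1) {i : ι} (hi : i ∉ S)
    {z : FreePt G} (hz : z ∈ cyc F c S ε) : relOp F i z ∈ bdy F c S ε := by
  have hpz := proj_mem_cyc F c hi hz
  have h1 : fill i (proj i z) ∈ bdy F c S ε := by
    have hf : relOp F i z ∈ cyc F c S ε :=
      map_mem_cyc F c (relOp F i) (fun _ h => relOp_mem_rel_of_mem F hi h)
        (fun a => relOp_act F i c a) hz
    rw [← sub_proj_relOp F]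
    exact sub_proj_mem_bdy F c hc hc1 hε hi hf
  have h2 := act_sub_mem_bdy F c hc hc1 hε (F.α i) hpz
  have h3 := act_sub_mem_bdy F c hc hc1 hε (F.β i) hpz
  have h4 := add_mem (sub_mem h1 h2) h3
  rw [relOp_apply]
  convert h4 using 1
  abel

/-- Adding the relations at `i` creates no new boundaries among old cycles, because the relation
`relOp F i z` that intervenes comes from a cycle and is therefore already a boundary. -/
theorem mem_bdy_of_mem_bdy_insert {S : Finset ι} {ε : ℤ} (hε : ε * ε = 1) {i : ι} (hi : i ∉ S)
    {a : FreePt G} (ha : a ∈ cyc F c S ε) (hb : a ∈ bdy F c (insert i S) ε) :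
    a ∈ bdy F c S ε := by
  obtain ⟨y, hy⟩ := (mem_bdy F c).1 hb
  rw [rel_insert] at hy
  obtain ⟨r, hr, _, ⟨z, rfl⟩, hrz⟩ := Submodule.mem_sup.1 hy
  have hbdy : y + ε • act c y ∈ bdy F c S ε :=
    (mem_bdy F c).2 ⟨y, by rw [sub_self]; exact zero_mem _⟩
  have h1 : relOp F i z ∈ cyc F c S ε := by
    have : relOp F i z = a - (y + ε • act c y) - r := by rw [← hrz, add_sub_cancel_left]
    rw [this]
    exact sub_mem (sub_mem ha (bdy_le_cyc F c hc S hε hbdy))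
      (bdy_le_cyc F c hc S hε (rel_le_bdy F c S ε hr))
  have h2 : proj i z ∈ cyc F c S ε := by
    rw [mem_cyc] at h1 ⊢
    rw [← relOp_act, ← map_zsmul, ← map_sub] at h1
    have h3 := proj_mem_rel_of_relOp_mem_rel F hi h1
    rwa [map_sub, map_zsmul, proj_act] at h3
  have h3 := relOp_mem_bdy_of_mem_cyc F c hc hc1 hε hi h2
  rw [relOp_proj_self] at h3
  have h4 : a = r + relOp F i z + (y + ε • act c y) := by rw [hrz, sub_add_cancel]
  rw [h4]
  exact add_mem (add_mem (rel_le_bdy F c S ε hr) h3) hbdy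

/-- The graph of the connecting homomorphism. -/
noncomputable def connecting (S : Finset ι) (i : ι) (ε : ℤ) : Submodule ℤ (FreePt G × FreePt G) :=
  (rel F S).comap ((LinearMap.id - ε • act c) ∘ₗ LinearMap.fst ℤ _ _
    - relOp F i ∘ₗ LinearMap.snd ℤ _ _) ⊓
  LinearMap.ker ((LinearMap.id - proj i) ∘ₗ LinearMap.snd ℤ _ _)

omit hc hc1 [Fintype ι] in
theorem mem_connecting {S : Finset ι} {i : ι} {ε : ℤ} {a z : FreePt G} :
    (a, z) ∈ connecting F c S i ε ↔ a - ε • act c a - relOp F i z ∈ rel F S ∧ proj i z = z := by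
  simp [connecting, sub_eq_zero, eq_comm (a := z)]

theorem map_fst_connecting {S : Finset ι} (i : ι) (ε : ℤ) :
    (connecting F c S i ε).toAddSubgroup.map (AddMonoidHom.fst _ _) =
      (cyc F c (insert i S) ε).toAddSubgroup := by
  ext a
  simp only [AddSubgroup.mem_map, Prod.exists, AddMonoidHom.coe_fst, exists_and_right,
    exists_eq_right, Submodule.mem_toAddSubgroup, mem_connecting, mem_cyc, rel_insert]
  constructor
  · rintro ⟨z, hz, -⟩
    rw [← sub_add_cancel (a - ε • act c a) (relOp F i z)]
    exact Submodule.add_mem_sup hz ⟨z, rfl⟩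
  · intro ha
    obtain ⟨r, hr, _, ⟨z, rfl⟩, hrz⟩ := Submodule.mem_sup.1 ha
    refine ⟨proj i z, ?_, proj_proj _ _⟩
    rwa [relOp_proj_self, ← hrz, add_sub_cancel_right]

/-- Surjectivity of the connecting homomorphism onto the cohomology of the opposite sign: `relOp F i
z` is a boundary `x - ε c x`, and `x` is the required preimage. -/
theorem map_snd_connecting {S : Finset ι} {i : ι} (hi : i ∉ S) {ε : ℤ} (hε : ε * ε = 1) :
    (connecting F c S i ε).toAddSubgroup.map (AddMonoidHom.snd _ _) ⊔
      (bdy F c S (-ε)).toAddSubgroup = (cyc F c S (-ε)).toAddSubgroup := by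
  have hε' : -ε * -ε = 1 := by simpa using hε
  apply le_antisymm
  · refine sup_le ?_ (bdy_le_cyc F c hc S hε')
    rintro _ ⟨⟨a, z⟩, h, rfl⟩
    obtain ⟨h, hz⟩ := (mem_connecting F c).1 h
    change z ∈ cyc F c S (-ε)
    rw [mem_cyc, ← hz, ← proj_act, ← map_zsmul, ← map_sub]
    refine proj_mem_rel_of_relOp_mem_rel F hi ?_
    have h2 := add_mem h ((rel F S).smul_mem ε (act_mem_rel F c h))
    rw [← neg_mem_iff]
    convert h2 using 1
    have h3 := smul_act_invol c hc hε a
    simp only [map_sub, map_zsmul, relOp_act, smul_sub, map_neg, neg_smul] at h3 ⊢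
    rw [h3]
    abel
  · intro z hz
    have hpz := proj_mem_cyc F c hi hz
    obtain ⟨x, hx⟩ := (mem_bdy F c).1 (relOp_mem_bdy_of_mem_cyc F c hc hc1 hε' hi hpz)
    rw [← add_sub_cancel (proj i z) z]
    refine AddSubgroup.add_mem_sup ⟨(x, proj i z), ?_, rfl⟩ (sub_proj_mem_bdy F c hc hc1 hε' hi hz)
    refine (mem_connecting F c).2 ⟨?_, proj_proj _ _⟩
    rw [← neg_mem_iff]
    convert hx using 1
    rw [neg_smul]
    abel

/-- Exactness: the kernel of the connecting homomorphism consists of the classes coming from cycles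
modulo `rel F S`. -/
theorem mem_connecting_comap {S : Finset ι} {i : ι} (hi : i ∉ S) {ε : ℤ} (hε : ε * ε = 1)
    {a z : FreePt G} (h : (a, z) ∈ connecting F c S i ε) :
    z ∈ bdy F c S (-ε) ↔ a ∈ bdy F c (insert i S) ε ⊔ cyc F c S ε := by
  obtain ⟨h, hz⟩ := (mem_connecting F c).1 h
  constructor
  · intro hb
    obtain ⟨y, hy⟩ := (mem_bdy F c).1 hb
    have h1 : a - relOp F i y ∈ cyc F c S ε := by
      have := add_mem h (relOp_mem_rel_of_mem F hi hy)
      rw [mem_cyc]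
      convert this using 1
      simp only [map_sub, map_add, map_neg, map_zsmul, relOp_act, neg_smul, smul_sub]
      abel
    have h2 : relOp F i y ∈ bdy F c (insert i S) ε :=
      rel_le_bdy F c _ ε (relOp_mem_rel F (Finset.mem_insert_self i S) y)
    have h3 := Submodule.add_mem_sup h2 h1
    rwa [add_sub_cancel] at h3
  · intro ha
    obtain ⟨b, hb, w, hw, rfl⟩ := Submodule.mem_sup.1 ha
    obtain ⟨y, hy⟩ := (mem_bdy F c).1 hb
    rw [rel_insert] at hy
    obtain ⟨r, hr, _, ⟨u, rfl⟩, hru⟩ := Submodule.mem_sup.1 hy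
    have hb' : b = r + relOp F i u + (y + ε • act c y) := by rw [hru, sub_add_cancel]
    have h1 : relOp F i (z - (u - ε • act c u)) ∈ rel F S := by
      have h2 := sub_mem (add_mem ((mem_cyc F c).1 hw)
        (sub_mem hr ((rel F S).smul_mem ε (act_mem_rel F c hr)))) h
      convert h2 using 1
      have h3 := smul_act_invol c hc hε y
      rw [hb']
      simp only [map_sub, map_add, map_zsmul, relOp_act, smul_add] at h3 ⊢
      rw [h3]
      abel
    have h2 := proj_mem_rel_of_relOp_mem_rel F hi h1
    refine (mem_bdy F c).2 ⟨proj i u, ?_⟩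
    rw [map_sub, hz, map_sub, map_zsmul, proj_act] at h2
    rwa [neg_smul, ← sub_eq_add_neg]

/-- The chain `B' ≤ B' ⊔ Z ≤ Z'` is the short exact sequence in the form of indices. The lower step
is the image of the old cohomology, the upper one is the target of the connecting homomorphism. -/
theorem presIndex_insert {S : Finset ι} {i : ι} (hi : i ∉ S) {ε : ℤ} (hε : ε * ε = 1) :
    presIndex F c (insert i S) ε = presIndex F c S ε * presIndex F c S (-ε) := by
  set B' := (bdy F c (insert i S) ε).toAddSubgroup with hB'
  set Z' := (cyc F c (insert i S) ε).toAddSubgroup with hZ'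
  set B := (bdy F c S ε).toAddSubgroup with hB
  set Z := (cyc F c S ε).toAddSubgroup with hZ
  set P := (connecting F c S i ε).toAddSubgroup with hP
  have hZZ' : Z ≤ Z' := cyc_mono F c (Finset.subset_insert i S) ε
  have hB'Z' : B' ≤ Z' := bdy_le_cyc F c hc _ hε
  have h1 : B'.relIndex (B' ⊔ Z) = presIndex F c S ε := by
    rw [sup_comm, AddSubgroup.relIndex_sup_right, ← AddSubgroup.inf_relIndex_right, presIndex]
    congr 1
    apply le_antisymm
    · rintro a ⟨ha, ha'⟩
      exact mem_bdy_of_mem_bdy_insert F c hc hc1 hε hi ha' ha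
    · exact le_inf (bdy_mono F c (Finset.subset_insert i S) ε) (bdy_le_cyc F c hc S hε)
  have h2 : (B' ⊔ Z).relIndex Z' = presIndex F c S (-ε) := by
    have h3 : (bdy F c S (-ε)).toAddSubgroup.relIndex (cyc F c S (-ε)).toAddSubgroup =
        ((bdy F c S (-ε)).toAddSubgroup.comap (AddMonoidHom.snd (FreePt G) (FreePt G)) ⊓ P).relIndex
          P := by
      rw [← map_snd_connecting F c hc hc1 hi hε, AddSubgroup.relIndex_sup_right,
        ← AddSubgroup.relIndex_comap, AddSubgroup.inf_relIndex_right]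
    rw [hZ', ← map_fst_connecting F c hc hc1 i ε, ← AddSubgroup.relIndex_comap, presIndex, h3,
      ← AddSubgroup.inf_relIndex_right]
    congr 1
    ext ⟨a, z⟩
    refine and_congr_left fun h => ?_
    refine Iff.trans ?_ (mem_connecting_comap F c hc hc1 hi hε h).symm
    rw [← Submodule.mem_toAddSubgroup, Submodule.sup_toAddSubgroup]
    rfl
  rw [← h1, ← h2, AddSubgroup.relIndex_mul_relIndex _ _ _ le_sup_left (sup_le hB'Z' hZZ')]
  rfl

theorem act_apply_zero (a : FreePt G) : act c a 0 = a 0 := by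
  classical
  have h : Finsupp.lapply (R := ℤ) 0 ∘ₗ act c = Finsupp.lapply (R := ℤ) (0 : Pt G) := by
    refine lhom_ext_single fun x => ?_
    simp only [LinearMap.comp_apply, act_single, Finsupp.lapply_apply, Finsupp.single_apply]
    have : tr c x = 0 ↔ x = 0 := by
      simp [funext_iff, tr_eq_zero_iff]
    simp [this]
  exact LinearMap.congr_fun h a

/-- In the permutation module only the orbit of the fixed point `0` can contribute to cohomology. -/
theorem sub_single_mem_bdy_empty {ε : ℤ} {a : FreePt G}
    (ha : a ∈ cyc F c ∅ ε) : a - Finsupp.single 0 (a 0) ∈ bdy F c ∅ ε := by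
  classical
  rw [mem_cyc, rel_empty, Submodule.mem_bot, sub_eq_zero] at ha
  obtain ⟨f, k, hf1, hf0, hk⟩ := exists_half_decomposition (tr c) (tr_invol c hc) (act c)
    (fun x => act_single c x)
  have hf : f = Finsupp.lsingle 0 ∘ₗ Finsupp.lapply (R := ℤ) (0 : Pt G) := by
    refine lhom_ext_single fun x => ?_
    by_cases hx : x = 0
    · rw [hf1 x ((tr_eq_self_iff c hc hc1 x).2 hx)]
      simp [hx]
    · rw [hf0 x (mt (tr_eq_self_iff c hc hc1 x).1 hx)]
      simp [hx]
  have hca : act c a = ε • a := by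
    conv_lhs => rw [ha, map_zsmul, act_invol c hc]
  have h := hk a
  rw [hf, hca, map_zsmul, map_zsmul] at h
  refine (mem_bdy F c).2 ⟨k a, ?_⟩
  convert zero_mem (rel F ∅) using 1
  nth_rewrite 1 [h]
  simp only [LinearMap.comp_apply, Finsupp.lapply_apply, Finsupp.lsingle_apply]
  abel

theorem presIndex_empty_neg_one : presIndex F c ∅ (-1) = 1 := by
  rw [presIndex, AddSubgroup.relIndex_eq_one]
  intro a ha
  have h := sub_single_mem_bdy_empty F c hc hc1 ha
  have h0 : a 0 = 0 := by
    have ha' := ha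
    rw [Submodule.mem_toAddSubgroup, mem_cyc, rel_empty, Submodule.mem_bot] at ha'
    have := DFunLike.congr_fun ha' 0
    simp only [neg_smul, one_smul, sub_neg_eq_add, Finsupp.add_apply, act_apply_zero c hc hc1,
      Finsupp.zero_apply] at this
    omega
  rwa [h0, Finsupp.single_zero, sub_zero] at h

theorem presIndex_empty_one : presIndex F c ∅ 1 = 2 := by
  set φ : FreePt G →+ ZMod 2 := (Int.castAddHom (ZMod 2)).comp (Finsupp.applyAddHom 0) with hφ
  have hφ' : ∀ a, φ a = (a 0 : ℤ) := fun a => rfl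
  have hδ : Finsupp.single 0 1 ∈ cyc F c ∅ 1 := by
    rw [mem_cyc, one_smul, act_single, (tr_eq_self_iff c hc hc1 0).2 rfl, sub_self]
    exact zero_mem _
  have h : (bdy F c ∅ 1).toAddSubgroup = φ.ker ⊓ (cyc F c ∅ 1).toAddSubgroup := by
    ext a
    rw [AddSubgroup.mem_inf, AddMonoidHom.mem_ker, hφ', ZMod.intCast_zmod_eq_zero_iff_dvd]
    constructor
    · intro ha
      refine ⟨?_, bdy_le_cyc F c hc ∅ (by norm_num) ha⟩
      obtain ⟨y, hy⟩ := (mem_bdy F c).1 ha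
      rw [rel_empty, Submodule.mem_bot, sub_eq_zero, one_smul] at hy
      rw [hy, Finsupp.add_apply, act_apply_zero c hc hc1, ← two_mul]
      exact dvd_mul_right _ _
    · rintro ⟨⟨n, hn⟩, ha⟩
      have h1 := sub_single_mem_bdy_empty F c hc hc1 ha
      have h2 : Finsupp.single 0 (a 0) ∈ bdy F c ∅ 1 := by
        refine (mem_bdy F c).2 ⟨n • Finsupp.single 0 1, ?_⟩
        rw [one_smul, map_zsmul, act_single, (tr_eq_self_iff c hc hc1 0).2 rfl, hn]
        convert zero_mem (rel F ∅) using 1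
        rw [← add_smul, Finsupp.smul_single, smul_eq_mul, mul_one, Nat.cast_ofNat, two_mul,
          sub_self]
      have h3 := add_mem h1 h2
      rwa [sub_add_cancel] at h3
  rw [presIndex, h, AddSubgroup.inf_relIndex_right, AddSubgroup.relIndex_ker]
  have hmap : (cyc F c ∅ 1).toAddSubgroup.map φ = ⊤ := by
    rw [eq_top_iff]
    rintro z -
    refine ⟨z.val • Finsupp.single 0 1, nsmul_mem hδ _, ?_⟩
    rw [map_nsmul, hφ']
    simp
  rw [hmap, AddSubgroup.card_top]
  simp

theorem presIndex_eq {S : Finset ι} (hS : S.Nonempty) : ∀ {ε : ℤ}, ε = 1 ∨ ε = -1 →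
    presIndex F c S ε = 2 ^ 2 ^ (S.card - 1) := by
  induction S using Finset.induction_on with
  | empty => exact absurd hS Finset.not_nonempty_empty
  | insert i S hi ih =>
    intro ε hε
    have hε2 : ε * ε = 1 := by rcases hε with rfl | rfl <;> norm_num
    rw [presIndex_insert F c hc hc1 hi hε2, Finset.card_insert_of_notMem hi, Nat.add_sub_cancel]
    -- The first index multiplies the unequal orders 2 and 1; from then on both signs have the same
    -- order, which is squared.
    rcases S.eq_empty_or_nonempty with rfl | hS
    · rcases hε with rfl | rfl
      · rw [presIndex_empty_one F c hc hc1, presIndex_empty_neg_one F c hc hc1]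
        norm_num
      · rw [neg_neg, presIndex_empty_one F c hc hc1, presIndex_empty_neg_one F c hc hc1]
        norm_num
    · have hcard := hS.card_pos
      rw [ih hS hε, ih hS (by rcases hε with rfl | rfl <;> simp), ← pow_add, ← two_mul,
        ← pow_succ', Nat.sub_add_cancel hcard]

end TateIndex

/-! ### Prime-power residue rings: a power of `p` times a unit -/

section PrimePower

variable {p e : ℕ} [hp : Fact p.Prime]

/-- The exponent of `p` in the canonical representative of `w`. -/
def lev (p : ℕ) {q : ℕ} (w : ZMod q) : ℕ := padicValNat p w.val

/-- This default value is essential: a vanishing coordinate contributes nothing to `depth`. -/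
theorem lev_zero (p q : ℕ) : lev p (0 : ZMod q) = 0 := by
  simp [lev]

theorem prime_pow_eq_zero_iff {k : ℕ} : ((p : ZMod (p ^ e)) ^ k = 0) ↔ e ≤ k := by
  rw [← Nat.cast_pow, ZMod.natCast_eq_zero_iff, Nat.pow_dvd_pow_iff_le_right hp.out.one_lt]

theorem pow_mul_unit_ne_zero {k : ℕ} (hk : k < e) (u : (ZMod (p ^ e))ˣ) :
    (p : ZMod (p ^ e)) ^ k * u ≠ 0 := by
  rw [Ne, Units.mul_left_eq_zero, prime_pow_eq_zero_iff]
  omega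

theorem exists_eq_pow_mul_unit {w : ZMod (p ^ e)} (hw : w ≠ 0) :
    ∃ u : (ZMod (p ^ e))ˣ, w = (p : ZMod (p ^ e)) ^ lev p w * u ∧ lev p w < e := by
  have : NeZero (p ^ e) := ⟨pow_ne_zero _ hp.out.ne_zero⟩
  have hv : w.val ≠ 0 := by rwa [Ne, ZMod.val_eq_zero]
  obtain ⟨n, hn⟩ : p ^ lev p w ∣ w.val := pow_padicValNat_dvd
  have hn0 : n ≠ 0 := by
    rintro rfl
    exact hv (by rw [hn, mul_zero])
  have hpn : ¬ p ∣ n := by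
    rintro ⟨n', rfl⟩
    have h1 : p ^ (lev p w + 1) ∣ w.val := ⟨n', by rw [hn, pow_succ, mul_assoc]⟩
    rw [padicValNat_dvd_iff_le hv] at h1
    exact absurd h1 (by unfold lev; omega)
  have hc : n.Coprime (p ^ e) :=
    Nat.Coprime.pow_right _ ((Nat.Prime.coprime_iff_not_dvd hp.out).2 hpn).symm
  refine ⟨ZMod.unitOfCoprime n hc, ?_, ?_⟩
  · rw [ZMod.coe_unitOfCoprime]
    conv_lhs => rw [← ZMod.natCast_zmod_val w, hn]
    push_cast
    rfl
  · rw [← Nat.pow_lt_pow_iff_right hp.out.one_lt]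
    refine lt_of_le_of_lt ?_ (ZMod.val_lt w)
    rw [hn]
    exact Nat.le_mul_of_pos_right _ (Nat.pos_of_ne_zero hn0)

theorem le_of_pow_mul_unit_eq {j k : ℕ} (hk : k < e) {u v : (ZMod (p ^ e))ˣ}
    (h : (p : ZMod (p ^ e)) ^ j * u = (p : ZMod (p ^ e)) ^ k * v) : j ≤ k := by
  by_contra! hjk
  -- Multiplying by this power pushes the side with exponent `k` to `p ^ (e - 1)` times a unit,
  -- which is nonzero, while the other side becomes zero.
  have h1 := congrArg (fun x => (p : ZMod (p ^ e)) ^ (e - 1 - k) * x) h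
  simp only [← mul_assoc, ← pow_add] at h1
  refine pow_mul_unit_ne_zero (k := e - 1 - k + k) (by omega) v (h1.symm.trans ?_)
  rw [prime_pow_eq_zero_iff.2 (by omega), zero_mul]

theorem lev_pow_mul_unit {k : ℕ} (hk : k < e) (u : (ZMod (p ^ e))ˣ) :
    lev p ((p : ZMod (p ^ e)) ^ k * (u : ZMod (p ^ e))) = k := by
  obtain ⟨v, hv, hlt⟩ := exists_eq_pow_mul_unit (pow_mul_unit_ne_zero hk u)
  exact le_antisymm (le_of_pow_mul_unit_eq hk hv.symm) (le_of_pow_mul_unit_eq hlt hv)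

theorem lev_unit (he : e ≠ 0) (u : (ZMod (p ^ e))ˣ) : lev p (u : ZMod (p ^ e)) = 0 := by
  simpa using lev_pow_mul_unit (Nat.pos_of_ne_zero he) u

theorem lev_unit_mul (u : (ZMod (p ^ e))ˣ) (w : ZMod (p ^ e)) : lev p ((u : ZMod (p ^ e)) * w) = lev p w := by
  by_cases hw : w = 0
  · simp [hw]
  · obtain ⟨v, hv, hlt⟩ := exists_eq_pow_mul_unit hw
    have : (u : ZMod (p ^ e)) * w = (p : ZMod (p ^ e)) ^ lev p w * ((u * v : (ZMod (p ^ e))ˣ)) := by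
      conv_lhs => rw [hv]
      push_cast
      ring
    rw [this, lev_pow_mul_unit hlt]

theorem lev_prime_mul {w : ZMod (p ^ e)} (hw : (p : ZMod (p ^ e)) * w ≠ 0) :
    lev p ((p : ZMod (p ^ e)) * w) = lev p w + 1 := by
  obtain ⟨u, hu, hlt⟩ := exists_eq_pow_mul_unit (right_ne_zero_of_mul hw)
  have h1 : (p : ZMod (p ^ e)) * w = (p : ZMod (p ^ e)) ^ (lev p w + 1) * u := by
    conv_lhs => rw [hu]
    ring
  have h2 : lev p w + 1 < e := by
    by_contra! h
    exact hw (by rw [h1, prime_pow_eq_zero_iff.2 h, zero_mul])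
  rw [h1, lev_pow_mul_unit h2]

theorem lev_of_prime_mul_eq_zero {w : ZMod (p ^ e)} (hw : w ≠ 0)
    (h : (p : ZMod (p ^ e)) * w = 0) : lev p w = e - 1 := by
  obtain ⟨u, hu, hlt⟩ := exists_eq_pow_mul_unit hw
  rw [hu, ← mul_assoc, ← pow_succ', Units.mul_left_eq_zero, prime_pow_eq_zero_iff] at h
  omega

theorem isUnit_of_pow_mul_eq {k : ℕ} (hk : k < e) {b : ZMod (p ^ e)} {u : (ZMod (p ^ e))ˣ}
    (h : (p : ZMod (p ^ e)) ^ k * b = (p : ZMod (p ^ e)) ^ k * u) : IsUnit b := by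
  have hb : b ≠ 0 := by
    rintro rfl
    exact pow_mul_unit_ne_zero hk u (by rw [← h, mul_zero])
  obtain ⟨v, hv, -⟩ := exists_eq_pow_mul_unit hb
  rw [hv, ← mul_assoc, ← pow_add] at h
  have h1 := le_of_pow_mul_unit_eq hk h
  have h2 : lev p b = 0 := by omega
  rw [h2, pow_zero, one_mul] at hv
  exact ⟨v, hv.symm⟩

end PrimePower

/-! ### Primary components, Frobenius elements and depth -/

section Coordinates

variable (m : ℕ)

/-- The primary component of `m` at `p`. -/
abbrev qp (p : m.primeFactors) : ℕ := (p : ℕ) ^ m.factorization p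

instance (p : m.primeFactors) : Fact (p : ℕ).Prime := ⟨Nat.prime_of_mem_primeFactors p.2⟩

instance (p : m.primeFactors) : NeZero (qp m p) :=
  ⟨pow_ne_zero _ (Nat.prime_of_mem_primeFactors p.2).ne_zero⟩

theorem factorization_ne_zero (p : m.primeFactors) : m.factorization p ≠ 0 :=
  Finsupp.mem_support_iff.1 p.2

/-- The product of the rings `ℤ/qℤ`, `q` running over the primary components of `m`. -/
abbrev ZProd : Type := ∀ p : m.primeFactors, ZMod (qp m p)

/-- The unit groups of the primary components. -/
abbrev GP (p : m.primeFactors) : Type := (ZMod (qp m p))ˣ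

noncomputable instance (p : m.primeFactors) : Fintype (WithZero (GP m p)) :=
  inferInstanceAs (Fintype (Option (GP m p)))

/-- The inclusion of `{0} ∪ G` into `ℤ/qℤ`. -/
def wval {q : ℕ} (w : WithZero (ZMod q)ˣ) : ZMod q :=
  WithZero.recZeroCoe (motive := fun _ => ZMod q) 0 (fun u => (u : ZMod q)) w

@[simp] theorem wval_zero {q : ℕ} : wval (0 : WithZero (ZMod q)ˣ) = 0 := rfl

@[simp] theorem wval_coe {q : ℕ} (u : (ZMod q)ˣ) : wval (u : WithZero (ZMod q)ˣ) = u := rfl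

theorem wval_coe_mul {q : ℕ} (u : (ZMod q)ˣ) (w : WithZero (ZMod q)ˣ) :
    wval ((u : WithZero (ZMod q)ˣ) * w) = (u : ZMod q) * wval w := by
  induction w using WithZero.recZeroCoe with
  | zero => simp
  | coe w => rw [← WithZero.coe_mul, wval_coe, wval_coe, Units.val_mul]

variable {m}

instance (p : m.primeFactors) : Nontrivial (ZMod (qp m p)) := by
  have : Fact (1 < qp m p) :=
    ⟨Nat.one_lt_pow (factorization_ne_zero m p) (Nat.prime_of_mem_primeFactors p.2).one_lt⟩
  infer_instance

theorem wval_eq_zero_iff {p : m.primeFactors} (w : WithZero (GP m p)) : wval w = 0 ↔ w = 0 := by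
  induction w using WithZero.recZeroCoe with
  | zero => simp
  | coe w => simp

theorem wval_injective {p : m.primeFactors} : Function.Injective (wval (q := qp m p)) := by
  intro v w h
  induction v using WithZero.recZeroCoe with
  | zero => exact ((wval_eq_zero_iff w).1 h.symm).symm
  | coe v =>
    induction w using WithZero.recZeroCoe with
    | zero => exact (wval_eq_zero_iff _).1 h
    | coe w => rw [Units.ext h]

theorem lev_wval {p : m.primeFactors} (w : WithZero (GP m p)) : lev p (wval w) = 0 := by
  induction w using WithZero.recZeroCoe with
  | zero => exact lev_zero _ _
  | coe w => exact lev_unit (factorization_ne_zero m p) w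

/-- The point of the product of rings attached to a point of the product of groups with zero. -/
def pval (x : Pt (GP m)) : ZProd m := fun p => wval (x p)

theorem pval_injective : Function.Injective (pval (m := m)) := fun _ _ h =>
  funext fun p => wval_injective (congrFun h p)

/-- A prime factor of `m` different from `p`, as a unit of the component at `p`; `1` at `p`. -/
def frob (l : m.primeFactors) : ∀ p, GP m p := fun p =>
  if h : p = l then 1 else ZMod.unitOfCoprime l
    (Nat.Coprime.pow_right _ ((Nat.coprime_primes (Nat.prime_of_mem_primeFactors l.2)
      (Nat.prime_of_mem_primeFactors p.2)).2 fun h' => h (Subtype.ext h'.symm)))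

theorem coe_frob {l p : m.primeFactors} (h : p ≠ l) :
    ((frob l p : GP m p) : ZMod (qp m p)) = ((l : ℕ) : ZMod (qp m p)) := by
  simp [frob, h]

/-- The exponents of Frobenius in the relations defining `U m`. -/
def twist (m : ℕ) : Twist (GP m) where
  α p := frob p ^ m.factorization p
  β p := frob p ^ (m.factorization p - 1)

/-- Multiplication by `l` is a translation here because the coordinate at `l`, where `frob l` has
the arbitrary value `1`, is zero. -/
theorem pval_tr_frob_pow (l : m.primeFactors) (k : ℕ) {x : Pt (GP m)} (hx : x l = 0) :
    pval (tr (frob l ^ k) x) = (((l : ℕ) ^ k : ℕ) : ZProd m) * pval x := by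
  funext p
  rw [Pi.mul_apply, Pi.natCast_apply, pval, tr, wval_coe_mul]
  by_cases h : p = l
  · subst h
    simp [pval, hx]
  · rw [Pi.pow_apply, Units.val_pow_eq_pow_val, coe_frob h, Nat.cast_pow]
    rfl

/-- The part of the index of `a` coming from the primes dividing its order. -/
def depth (a : ZProd m) : ℕ := ∏ p : m.primeFactors, (p : ℕ) ^ lev p (a p)

theorem depth_congr {a b : ZProd m} (h : ∀ p : m.primeFactors, lev p (a p) = lev p (b p)) :
    depth a = depth b := by
  simp only [depth, h]

theorem depth_mul {a b : ZProd m} (l : m.primeFactors) (k : ℕ)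
    (hl : lev l (a l) = lev l (b l) + k) (h : ∀ p ≠ l, lev p (a p) = lev p (b p)) :
    depth a = (l : ℕ) ^ k * depth b := by
  rw [depth, depth, Fintype.prod_eq_mul_prod_compl l, Fintype.prod_eq_mul_prod_compl l, hl, pow_add,
    Finset.prod_congr rfl (g := fun p : m.primeFactors => (p : ℕ) ^ lev p (b p))]
  · ring
  · intro p hp
    rw [h p (by simpa using hp)]

theorem exists_unit_depth (a : ZProd m) (l : m.primeFactors) : ∃ u : GP m l,
    (depth a : ZMod (qp m l)) = ((l : ℕ) : ZMod (qp m l)) ^ lev l (a l) * u := by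
  rw [depth, Fintype.prod_eq_mul_prod_compl l]
  push_cast
  have : IsUnit (∏ p ∈ ({l}ᶜ : Finset m.primeFactors),
      ((p : ℕ) : ZMod (qp m l)) ^ lev p (a p)) := by
    rw [IsUnit.prod_iff]
    intro p hp
    have hp : l ≠ p := by
      rintro rfl
      simp at hp
    rw [← coe_frob hp]
    exact (Units.isUnit _).pow _
  obtain ⟨u, hu⟩ := this
  exact ⟨u, by rw [hu]⟩

end Coordinates

/-! ### Lifting arbitrary symbols to sums of points -/

section Lifts

variable {m : ℕ}

open Classical in
/-- The points `x` with `depth a * x = a` having the same vanishing coordinates as `a`. -/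
noncomputable def lifts (a : ZProd m) : Finset (Pt (GP m)) :=
  Finset.univ.filter fun x => (depth a : ZProd m) * pval x = a ∧ ∀ p, x p = 0 ↔ a p = 0

/-- The sum of the points in `lifts a`. -/
noncomputable def liftSum (a : ZProd m) : FreePt (GP m) := ∑ x ∈ lifts a, Finsupp.single x 1

open Classical in
/-- The solutions of `n * b = a`. -/
noncomputable def fiber (n : ℕ) (a : ZProd m) : Finset (ZProd m) :=
  Finset.univ.filter fun b => (n : ZProd m) * b = a

theorem mem_lifts {a : ZProd m} {x : Pt (GP m)} :
    x ∈ lifts a ↔ (depth a : ZProd m) * pval x = a ∧ ∀ p, x p = 0 ↔ a p = 0 := by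
  simp [lifts]

theorem mem_fiber {n : ℕ} {a b : ZProd m} : b ∈ fiber n a ↔ (n : ZProd m) * b = a := by
  simp [fiber]

theorem prime_mul_cancel {l p : m.primeFactors} (h : p ≠ l) {v w : ZMod (qp m p)}
    (hvw : ((l : ℕ) : ZMod (qp m p)) * v = ((l : ℕ) : ZMod (qp m p)) * w) : v = w := by
  rw [← coe_frob h] at hvw
  exact (Units.mul_right_inj _).1 hvw

theorem prime_mul_eq_zero_iff {l p : m.primeFactors} (h : p ≠ l) {v : ZMod (qp m p)} :
    ((l : ℕ) : ZMod (qp m p)) * v = 0 ↔ v = 0 :=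
  ⟨fun hv => prime_mul_cancel h (by rw [hv, mul_zero]), fun hv => by rw [hv, mul_zero]⟩

theorem lev_prime_mul_of_ne {l p : m.primeFactors} (h : p ≠ l) (v : ZMod (qp m p)) :
    lev p (((l : ℕ) : ZMod (qp m p)) * v) = lev p v := by
  rw [← coe_frob h, lev_unit_mul]

theorem pval_apply_eq_zero_iff {x : Pt (GP m)} {p : m.primeFactors} : pval x p = 0 ↔ x p = 0 :=
  wval_eq_zero_iff _

/-- The relation attached to a prime, when the coordinate at that prime does not vanish. -/
theorem liftSum_eq_sum_fiber {l : m.primeFactors} {a b₀ : ZProd m} (hab : ((l : ℕ) : ZProd m) * b₀ = a)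
    (ha : a l ≠ 0) : ∑ b ∈ fiber l a, liftSum b = liftSum a := by
  classical
  have hcoord : ∀ {b : ZProd m}, b ∈ fiber l a → ∀ p, ((l : ℕ) : ZMod (qp m p)) * b p = a p :=
    fun hb p => congrFun (mem_fiber.1 hb) p
  have hdepth : ∀ b ∈ fiber l a, depth a = l * depth b := by
    intro b hb
    rw [depth_mul l 1 (b := b), pow_one]
    · rw [← hcoord hb l] at ha ⊢
      exact lev_prime_mul ha
    · intro p hp
      rw [← hcoord hb p, lev_prime_mul_of_ne hp]
  have hl0 : (l : ℕ) ≠ 0 := (Nat.prime_of_mem_primeFactors l.2).ne_zero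
  have hb₀ : b₀ ∈ fiber l a := mem_fiber.2 hab
  have hN : ∀ b ∈ fiber l a, depth b = depth b₀ := fun b hb =>
    Nat.eq_of_mul_eq_mul_left (Nat.pos_of_ne_zero hl0) ((hdepth b hb).symm.trans (hdepth b₀ hb₀))
  have hpat : ∀ b ∈ fiber l a, ∀ p, b p = 0 ↔ a p = 0 := by
    intro b hb p
    by_cases hp : p = l
    · subst hp
      refine iff_of_false (fun h => ha ?_) ha
      rw [← hcoord hb p, h, mul_zero]
    · rw [← hcoord hb p, prime_mul_eq_zero_iff hp]
  -- All solutions `b` share one depth, so the lifts of `a` are sorted by the `b` they pass through.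
  have hmaps : ∀ x ∈ lifts a, (depth b₀ : ZProd m) * pval x ∈ fiber l a := by
    intro x hx
    rw [mem_fiber, ← mul_assoc, ← Nat.cast_mul, ← hdepth b₀ hb₀]
    exact (mem_lifts.1 hx).1
  rw [liftSum, ← Finset.sum_fiberwise_of_maps_to hmaps]
  refine Finset.sum_congr rfl fun b hb => Finset.sum_congr ?_ fun _ _ => rfl
  ext x
  rw [Finset.mem_filter, mem_lifts, mem_lifts, hN b hb]
  constructor
  · rintro ⟨h1, h2⟩
    refine ⟨⟨?_, fun p => (h2 p).trans (hpat b hb p)⟩, h1⟩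
    rw [hdepth b₀ hb₀, Nat.cast_mul, mul_assoc, h1, mem_fiber.1 hb]
  · rintro ⟨⟨-, h2⟩, h1⟩
    exact ⟨h1, fun p => (h2 p).trans (hpat b hb p).symm⟩

theorem tr_inv_tr (t : ∀ p, GP m p) (x : Pt (GP m)) : tr t⁻¹ (tr t x) = x := by
  rw [tr_tr, inv_mul_cancel, tr_one]

theorem tr_tr_inv (t : ∀ p, GP m p) (x : Pt (GP m)) : tr t (tr t⁻¹ x) = x := by
  rw [tr_tr, mul_inv_cancel, tr_one]

theorem liftSum_eq_sum_tr {a : ZProd m} (s : Finset (Pt (GP m))) (t : ∀ p, GP m p)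
    (h : ∀ z, z ∈ s ↔ tr t z ∈ lifts a) :
    liftSum a = ∑ z ∈ s, Finsupp.single (tr t z) 1 := by
  refine Finset.sum_bij' (fun y _ => tr t⁻¹ y) (fun z _ => tr t z) ?_ ?_ ?_ ?_ ?_
  · intro y hy
    rw [h, tr_tr_inv]
    exact hy
  · intro z hz
    exact (h z).1 hz
  · intro y _
    exact tr_tr_inv t y
  · intro z _
    exact tr_inv_tr t z
  · intro y _
    rw [tr_tr_inv]

theorem relOp_twist_single {l : m.primeFactors} {z : Pt (GP m)} (hz : z l = 0) :
    relOp (twist m) l (Finsupp.single z 1) =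
      ∑ u : GP m l, Finsupp.single (Function.update z l (u : WithZero (GP m l))) 1
      - Finsupp.single (tr (frob l ^ m.factorization l) z) 1
      + Finsupp.single (tr (frob l ^ (m.factorization l - 1)) z) 1 := by
  classical
  rw [relOp_apply, proj_single, if_pos hz, fill_single, act_single, act_single]
  rfl

/-- The relation attached to a prime, when the coordinate at that prime vanishes. -/
theorem sum_fiber_sub_liftSum {l : m.primeFactors} {a b₀ : ZProd m}
    (hab : ((l : ℕ) : ZProd m) * b₀ = a) (ha : a l = 0) :
    ∃ s : Finset (Pt (GP m)), (∀ z ∈ s, z l = 0) ∧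
      ∑ b ∈ fiber l a, liftSum b - liftSum a =
        ∑ z ∈ s, relOp (twist m) l (Finsupp.single z 1) := by
  classical
  have hl0 := factorization_ne_zero m l
  set e := m.factorization l with he
  -- `b₁` is the only solution vanishing at `l`. All others have level `e - 1` there, hence the
  -- larger depth `M`.
  set b₁ : ZProd m := Function.update b₀ l 0 with hb₁
  have hb₁l : b₁ l = 0 := by simp [hb₁]
  have hab₁ : ((l : ℕ) : ZProd m) * b₁ = a := by
    funext p
    by_cases hp : p = l
    · subst hp
      rw [Pi.mul_apply, hb₁l, mul_zero, ha]
    · rw [← hab, Pi.mul_apply, Pi.mul_apply, hb₁, Function.update_of_ne hp]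
  have hcoord : ∀ p, ((l : ℕ) : ZMod (qp m p)) * b₁ p = a p := fun p => congrFun hab₁ p
  have hpat : ∀ p, b₁ p = 0 ↔ a p = 0 := by
    intro p
    by_cases hp : p = l
    · subst hp
      exact iff_of_true hb₁l ha
    · rw [← hcoord p, prime_mul_eq_zero_iff hp]
  set N := depth b₁ with hN
  have hda : depth a = N := depth_congr fun p => by
    by_cases hp : p = l
    · subst hp
      rw [ha, hb₁l]
    · rw [← hcoord p, lev_prime_mul_of_ne hp]
  set M := (l : ℕ) ^ (e - 1) * N with hM
  have hfib : ∀ b, b ∈ fiber l a ↔ (∀ p ≠ l, b p = b₁ p) ∧ ((l : ℕ) : ZMod (qp m l)) * b l = 0 := by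
    intro b
    rw [mem_fiber, funext_iff]
    constructor
    · intro h
      refine ⟨fun p hp => prime_mul_cancel hp ((h p).trans (hcoord p).symm), ?_⟩
      rw [← ha, ← h l]
      rfl
    · rintro ⟨h1, h2⟩ p
      by_cases hp : p = l
      · subst hp
        rw [ha, ← h2]
        rfl
      · rw [← hcoord p, ← h1 p hp]
        rfl
  have hb₁fib : b₁ ∈ fiber l a := mem_fiber.2 hab₁
  have hdepth : ∀ b ∈ fiber l a, b l ≠ 0 → depth b = M := by
    intro b hb hbl
    obtain ⟨h1, h2⟩ := (hfib b).1 hb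
    refine depth_mul l (e - 1) ?_ fun p hp => by rw [h1 p hp]
    rw [hb₁l, lev_zero, zero_add]
    exact lev_of_prime_mul_eq_zero hbl h2
  -- The points `z` with `M z = b₁` parametrize all three terms: `Frob ^ (e - 1) z` lifts `b₁`,
  -- `Frob ^ e z` lifts `a`, and filling coordinate `l` of `z` by units gives the lifts of the other
  -- solutions.
  set s : Finset (Pt (GP m)) := Finset.univ.filter
    (fun z => z l = 0 ∧ (M : ZProd m) * pval z = b₁ ∧ ∀ p, z p = 0 ↔ b₁ p = 0) with hs
  have hmem : ∀ z, z ∈ s ↔ z l = 0 ∧ (M : ZProd m) * pval z = b₁ ∧ ∀ p, z p = 0 ↔ b₁ p = 0 :=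
    fun z => by simp [hs]
  have hβ : liftSum b₁ = ∑ z ∈ s, Finsupp.single (tr (frob l ^ (e - 1)) z) 1 := by
    refine liftSum_eq_sum_tr s _ fun z => ?_
    rw [hmem, mem_lifts]
    simp only [tr_eq_zero_iff]
    constructor
    · rintro ⟨h1, h2, h3⟩
      refine ⟨?_, h3⟩
      rw [pval_tr_frob_pow l _ h1, ← mul_assoc, ← Nat.cast_mul, mul_comm _ (_ ^ _)]
      exact h2
    · rintro ⟨h2, h3⟩
      have h1 : z l = 0 := (h3 l).2 hb₁l
      refine ⟨h1, ?_, h3⟩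
      rw [pval_tr_frob_pow l _ h1, ← mul_assoc, ← Nat.cast_mul, mul_comm _ (_ ^ _)] at h2
      exact h2
  have hα : liftSum a = ∑ z ∈ s, Finsupp.single (tr (frob l ^ e) z) 1 := by
    refine liftSum_eq_sum_tr s _ fun z => ?_
    have hle : N * (l : ℕ) ^ e = l * M := by
      rw [hM, ← mul_assoc, ← pow_succ', Nat.sub_add_cancel (Nat.pos_of_ne_zero hl0), mul_comm]
    rw [hmem, mem_lifts, hda]
    simp only [tr_eq_zero_iff]
    constructor
    · rintro ⟨h1, h2, h3⟩
      refine ⟨?_, fun p => (h3 p).trans (hpat p)⟩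
      rw [pval_tr_frob_pow l _ h1, ← mul_assoc, ← Nat.cast_mul, hle, Nat.cast_mul, mul_assoc, h2,
        hab₁]
    · rintro ⟨h2, h3⟩
      have h1 : z l = 0 := (h3 l).2 ha
      refine ⟨h1, ?_, fun p => (h3 p).trans (hpat p).symm⟩
      rw [pval_tr_frob_pow l _ h1, ← mul_assoc, ← Nat.cast_mul, hle, Nat.cast_mul, mul_assoc] at h2
      funext p
      by_cases hp : p = l
      · subst hp
        rw [hb₁l, Pi.mul_apply, pval_apply_eq_zero_iff.2 h1, mul_zero]
      · exact prime_mul_cancel hp ((congrFun h2 p).trans (hcoord p).symm)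
  set t : Finset (Pt (GP m)) := Finset.univ.filter
    (fun x => x l ≠ 0 ∧ ∀ p ≠ l, ((M : ZProd m) * pval x) p = b₁ p ∧ (x p = 0 ↔ b₁ p = 0)) with ht
  have hmemt : ∀ x, x ∈ t ↔ x l ≠ 0 ∧ ∀ p ≠ l, ((M : ZProd m) * pval x) p = b₁ p ∧
      (x p = 0 ↔ b₁ p = 0) := fun x => by simp [ht]
  have hunit : ∀ x : Pt (GP m), x l ≠ 0 → ((M : ZProd m) * pval x) l ≠ 0 ∧
      ((l : ℕ) : ZMod (qp m l)) * ((M : ZProd m) * pval x) l = 0 := by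
    intro x hx
    obtain ⟨u, hu⟩ := WithZero.ne_zero_iff_exists.1 hx
    obtain ⟨v, hv⟩ := exists_unit_depth b₁ l
    rw [hb₁l, lev_zero, pow_zero, one_mul] at hv
    have h1 : ((M : ZProd m) * pval x) l = ((l : ℕ) : ZMod (qp m l)) ^ (e - 1) *
        ((v * u : GP m l) : ZMod (qp m l)) := by
      rw [Pi.mul_apply, Pi.natCast_apply, hM, Nat.cast_mul, Nat.cast_pow, hv, pval, ← hu, wval_coe,
        Units.val_mul, mul_assoc]
    rw [h1]
    refine ⟨pow_mul_unit_ne_zero (by omega) _, ?_⟩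
    rw [← mul_assoc, ← pow_succ', prime_pow_eq_zero_iff.2 (by omega), zero_mul]
  have hfill : ∑ b ∈ (fiber l a).erase b₁, liftSum b = ∑ x ∈ t, Finsupp.single x 1 := by
    have hmaps : ∀ x ∈ t, (M : ZProd m) * pval x ∈ (fiber l a).erase b₁ := by
      intro x hx
      obtain ⟨h1, h2⟩ := (hmemt x).1 hx
      obtain ⟨h3, h4⟩ := hunit x h1
      refine Finset.mem_erase.2 ⟨fun h => h3 (by rw [h, hb₁l]), (hfib _).2 ⟨fun p hp => (h2 p hp).1, h4⟩⟩
    rw [← Finset.sum_fiberwise_of_maps_to hmaps]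
    refine Finset.sum_congr rfl fun b hb => Finset.sum_congr ?_ fun _ _ => rfl
    obtain ⟨hb1, hb2⟩ := Finset.mem_erase.1 hb
    obtain ⟨h3, h4⟩ := (hfib b).1 hb2
    have hbl : b l ≠ 0 := by
      intro h
      refine hb1 (funext fun p => ?_)
      by_cases hp : p = l
      · subst hp
        rw [h, hb₁l]
      · exact h3 p hp
    ext x
    rw [Finset.mem_filter, mem_lifts, hmemt, hdepth b hb2 hbl]
    constructor
    · rintro ⟨h1, h2⟩
      refine ⟨⟨mt (h2 l).1 hbl, fun p hp => ⟨?_, ?_⟩⟩, h1⟩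
      · rw [h1, h3 p hp]
      · rw [h2 p, h3 p hp]
    · rintro ⟨⟨h1, h2⟩, h5⟩
      refine ⟨h5, fun p => ?_⟩
      by_cases hp : p = l
      · subst hp
        exact iff_of_false h1 hbl
      · rw [(h2 p hp).2, h3 p hp]
  have hfill' : ∑ x ∈ t, Finsupp.single x (1 : ℤ) = ∑ z ∈ s, ∑ u : GP m l,
      Finsupp.single (Function.update z l (u : WithZero (GP m l))) 1 := by
    rw [← Finset.sum_product']
    symm
    have hupd : ∀ (z : Pt (GP m)) (w : WithZero (GP m l)) (p) (_ : p ≠ l),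
        ((M : ZProd m) * pval (Function.update z l w)) p = ((M : ZProd m) * pval z) p := by
      intro z w p hp
      rw [Pi.mul_apply, Pi.mul_apply, pval, pval, Function.update_of_ne hp]
    refine Finset.sum_bij (fun zu _ => Function.update zu.1 l (zu.2 : WithZero (GP m l))) ?_ ?_ ?_ ?_
    · rintro ⟨z, u⟩ hz
      obtain ⟨h1, h2, h3⟩ := (hmem z).1 (Finset.mem_product.1 hz).1
      refine (hmemt _).2 ⟨by simp, fun p hp => ⟨?_, ?_⟩⟩
      · rw [hupd z _ p hp, h2]
      · change Function.update z l _ p = 0 ↔ _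
        rw [Function.update_of_ne hp, h3 p]
    · rintro ⟨z, u⟩ hz ⟨z', u'⟩ hz' h
      have h1 := ((hmem z).1 (Finset.mem_product.1 hz).1).1
      have h1' := ((hmem z').1 (Finset.mem_product.1 hz').1).1
      have hu : u = u' := by simpa using congrFun h l
      refine Prod.ext (funext fun p => ?_) hu
      by_cases hp : p = l
      · subst hp
        exact h1.trans h1'.symm
      · simpa [Function.update_of_ne hp] using congrFun h p
    · intro x hx
      obtain ⟨h1, h2⟩ := (hmemt x).1 hx
      obtain ⟨u, hu⟩ := WithZero.ne_zero_iff_exists.1 h1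
      refine ⟨(Function.update x l 0, u), Finset.mem_product.2 ⟨(hmem _).2 ⟨by simp, ?_, ?_⟩,
        Finset.mem_univ _⟩, ?_⟩
      · funext p
        by_cases hp : p = l
        · subst hp
          rw [hb₁l, Pi.mul_apply]
          change _ * wval (Function.update x p 0 p) = 0
          rw [Function.update_self, wval_zero, mul_zero]
        · rw [hupd x _ p hp, (h2 p hp).1]
      · intro p
        by_cases hp : p = l
        · subst hp
          simp [hb₁l]
        · change Function.update x l 0 p = 0 ↔ _
          rw [Function.update_of_ne hp, (h2 p hp).2]
      · change Function.update (Function.update x l 0) l (u : WithZero (GP m l)) = x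
        rw [Function.update_idem, hu, Function.update_eq_self]
    · intros
      rfl
  refine ⟨s, fun z hz => ((hmem z).1 hz).1, ?_⟩
  rw [← Finset.add_sum_erase _ _ hb₁fib, hfill, hfill', hα, hβ,
    Finset.sum_congr rfl fun z hz => relOp_twist_single ((hmem z).1 hz).1, Finset.sum_add_distrib,
    Finset.sum_sub_distrib]
  abel

theorem liftSum_sub_sum_fiber_prime_mem {l : m.primeFactors} {a b₀ : ZProd m}
    (hab : ((l : ℕ) : ZProd m) * b₀ = a) :
    liftSum a - ∑ b ∈ fiber l a, liftSum b ∈ rel (twist m) Finset.univ := by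
  by_cases ha : a l = 0
  · obtain ⟨s, -, h⟩ := sum_fiber_sub_liftSum hab ha
    rw [← neg_mem_iff, neg_sub, h]
    exact sum_mem fun z _ => relOp_mem_rel _ (Finset.mem_univ l) _
  · rw [liftSum_eq_sum_fiber hab ha, sub_self]
    exact zero_mem _

end Lifts

/-! ### Composite divisors, and points as generators -/

section Composite

variable {m : ℕ}

theorem exists_natCast_mul_of_natCast_mul_eq_zero (hm : m ≠ 0) {k n : ℕ} (hk : k ≠ 0)
    (hkn : k * n ∣ m) {w : ZProd m} (hw : (k : ZProd m) * w = 0) : ∃ v, w = (n : ZProd m) * v := by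
  have : NeZero m := ⟨hm⟩
  obtain ⟨z, rfl⟩ := (ZMod.equivPi m hm).surjective w
  rw [← map_natCast (ZMod.equivPi m hm), ← map_mul, map_eq_zero_iff _ (ZMod.equivPi m hm).injective,
    ← ZMod.natCast_zmod_val z, ← Nat.cast_mul, ZMod.natCast_eq_zero_iff] at hw
  obtain ⟨j, hj⟩ := Nat.dvd_of_mul_dvd_mul_left (Nat.pos_of_ne_zero hk) (hkn.trans hw)
  refine ⟨ZMod.equivPi m hm j, ?_⟩
  rw [← map_natCast (ZMod.equivPi m hm), ← map_mul, ← Nat.cast_mul, ← hj, ZMod.natCast_zmod_val]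

theorem sum_fiber_mul {A : Type*} [AddCommMonoid A] (φ : ZProd m → A) (k n : ℕ) (a : ZProd m) :
    ∑ b ∈ fiber (k * n) a, φ b = ∑ b' ∈ fiber k a, ∑ b ∈ fiber n b', φ b := by
  classical
  have hmaps : ∀ b ∈ fiber (k * n) a, (n : ZProd m) * b ∈ fiber k a := by
    intro b hb
    rw [mem_fiber] at hb ⊢
    rw [← mul_assoc, ← Nat.cast_mul, hb]
  rw [← Finset.sum_fiberwise_of_maps_to hmaps]
  refine Finset.sum_congr rfl fun b' hb' => Finset.sum_congr ?_ fun _ _ => rfl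
  ext b
  rw [Finset.mem_filter, mem_fiber, mem_fiber]
  refine ⟨fun h => h.2, fun h => ⟨?_, h⟩⟩
  rw [Nat.cast_mul, mul_assoc, h, mem_fiber.1 hb']

/-- Fibres of a product are iterated fibres, so the relations at primes imply all of them. -/
theorem liftSum_sub_sum_fiber_mem (hm : m ≠ 0) (n : ℕ) (hn : n ∣ m) (b₀ : ZProd m) :
    liftSum ((n : ZProd m) * b₀) - ∑ b ∈ fiber n ((n : ZProd m) * b₀), liftSum b ∈
      rel (twist m) Finset.univ := by
  induction n using induction_on_primes generalizing b₀ with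
  | zero => exact absurd (Nat.eq_zero_of_zero_dvd hn) hm
  | one =>
    have : fiber 1 (((1 : ℕ) : ZProd m) * b₀) = {b₀} := by
      ext b
      simp [mem_fiber]
    rw [this, Finset.sum_singleton, Nat.cast_one, one_mul, sub_self]
    exact zero_mem _
  | prime_mul p n hp ih =>
    let l : m.primeFactors := ⟨p, Nat.mem_primeFactors.2 ⟨hp, (dvd_mul_right p n).trans hn, hm⟩⟩
    have h1 := liftSum_sub_sum_fiber_prime_mem (l := l) (b₀ := (n : ZProd m) * b₀) rfl
    rw [← mul_assoc, ← Nat.cast_mul] at h1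
    change liftSum (((p * n : ℕ) : ZProd m) * b₀) -
      ∑ b ∈ fiber p (((p * n : ℕ) : ZProd m) * b₀), liftSum b ∈ _ at h1
    rw [sum_fiber_mul]
    have h2 : ∑ b' ∈ fiber p (((p * n : ℕ) : ZProd m) * b₀),
        (liftSum b' - ∑ b ∈ fiber n b', liftSum b) ∈ rel (twist m) Finset.univ := by
      refine sum_mem fun b' hb' => ?_
      rw [mem_fiber] at hb'
      -- The induction hypothesis needs `b'` to be a multiple of `n`. It differs from one by
      -- `p`-torsion, which consists of multiples of `n` because `p * n ∣ m`.
      obtain ⟨v, hv⟩ := exists_natCast_mul_of_natCast_mul_eq_zero hm hp.ne_zero hn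
        (w := b' - (n : ZProd m) * b₀) (by rw [mul_sub, hb', Nat.cast_mul, mul_assoc, sub_self])
      have hb : b' = (n : ZProd m) * (v + b₀) := by rw [mul_add, ← hv, sub_add_cancel]
      rw [hb]
      exact ih ((dvd_mul_left n p).trans hn) _
    rw [Finset.sum_sub_distrib] at h2
    have h3 := add_mem h1 h2
    rwa [sub_add_sub_cancel] at h3

theorem depth_pval (x : Pt (GP m)) : depth (pval x) = 1 :=
  Finset.prod_eq_one fun p _ => by rw [pval, lev_wval, pow_zero]

theorem liftSum_pval (x : Pt (GP m)) : liftSum (pval x) = Finsupp.single x 1 := by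
  have : lifts (pval x) = {x} := by
    ext y
    rw [mem_lifts, depth_pval, Nat.cast_one, one_mul, pval_injective.eq_iff, Finset.mem_singleton]
    refine ⟨fun h => h.1, ?_⟩
    rintro rfl
    exact ⟨rfl, fun p => pval_apply_eq_zero_iff.symm⟩
  rw [liftSum, this, Finset.sum_singleton]

theorem exists_pval_eq {b : ZProd m} (h : ∀ p, b p = 0 ∨ IsUnit (b p)) : ∃ x, pval x = b := by
  have : ∀ p, ∃ w : WithZero (GP m p), wval w = b p := by
    intro p
    rcases h p with h | ⟨u, hu⟩
    · exact ⟨0, by rw [h, wval_zero]⟩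
    · exact ⟨u, by rw [wval_coe, hu]⟩
  choose x hx using this
  exact ⟨x, funext hx⟩

theorem lev_le (a : ZProd m) (p : m.primeFactors) : lev p (a p) ≤ m.factorization p := by
  by_cases h : a p = 0
  · rw [h, lev_zero]
    exact Nat.zero_le _
  · obtain ⟨_, -, h⟩ := exists_eq_pow_mul_unit h
    exact h.le

theorem depth_dvd (hm : m ≠ 0) (a : ZProd m) : depth a ∣ m := by
  have h : ∏ p : m.primeFactors, (p : ℕ) ^ m.factorization p = m := by
    conv_rhs => rw [← Nat.prod_factorization_pow_eq_self hm]
    exact Finset.prod_coe_sort m.primeFactors fun p => p ^ m.factorization p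
  conv_rhs => rw [← h]
  exact Finset.prod_dvd_prod_of_dvd _ _ fun p _ => pow_dvd_pow _ (lev_le a p)

theorem exists_depth_mul_eq (a : ZProd m) : ∃ b, (depth a : ZProd m) * b = a := by
  have : ∀ p, ∃ b, (depth a : ZMod (qp m p)) * b = a p := by
    intro p
    by_cases h : a p = 0
    · exact ⟨0, by rw [mul_zero, h]⟩
    · obtain ⟨v, hv, -⟩ := exists_eq_pow_mul_unit h
      obtain ⟨u, hu⟩ := exists_unit_depth a p
      refine ⟨((u⁻¹ * v : GP m p) : ZMod (qp m p)), ?_⟩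
      conv_rhs => rw [hv]
      rw [hu, mul_assoc, ← Units.val_mul, mul_inv_cancel_left]
  choose b hb using this
  exact ⟨b, funext hb⟩

/-- Every solution of `depth a * b = a` has only zero or unit coordinates: `depth a` is a unit where
`a` vanishes and carries the full power of `p` elsewhere. The relation for `n = depth a` therefore
expresses `[a]` through points. -/
theorem sum_fiber_depth {A : Type*} [AddCommMonoid A] (φ : ZProd m → A) (a : ZProd m) :
    ∑ b ∈ fiber (depth a) a, φ b = ∑ x ∈ lifts a, φ (pval x) := by
  symm
  refine Finset.sum_bij (fun x _ => pval x) ?_ ?_ ?_ ?_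
  · intro x hx
    exact mem_fiber.2 (mem_lifts.1 hx).1
  · intro x _ y _ h
    exact pval_injective h
  · intro b hb
    rw [mem_fiber] at hb
    have hcoord : ∀ p, (depth a : ZMod (qp m p)) * b p = a p := fun p => congrFun hb p
    have hzero : ∀ p, a p = 0 → b p = 0 := by
      intro p hp
      obtain ⟨u, hu⟩ := exists_unit_depth a p
      rw [hp, lev_zero, pow_zero, one_mul] at hu
      have := hcoord p
      rw [hu, hp] at this
      exact (Units.mul_right_eq_zero u).1 this
    have hunit : ∀ p, a p ≠ 0 → IsUnit (b p) := by
      intro p hp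
      obtain ⟨u, hu⟩ := exists_unit_depth a p
      obtain ⟨v, hv, hlt⟩ := exists_eq_pow_mul_unit hp
      have := hcoord p
      rw [hu, mul_assoc] at this
      exact isUnit_of_mul_isUnit_right (isUnit_of_pow_mul_eq hlt (this.trans hv))
    obtain ⟨x, rfl⟩ := exists_pval_eq (b := b) fun p => (em (a p = 0)).imp (hzero p) (hunit p)
    refine ⟨x, mem_lifts.2 ⟨hb, fun p => ?_⟩, rfl⟩
    rw [← pval_apply_eq_zero_iff]
    refine ⟨fun h => ?_, hzero p⟩
    rw [← hcoord p, h, mul_zero]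
  · intros
    rfl

theorem mem_fiber_prime_pow {l : m.primeFactors} {k : ℕ} {v b : ZProd m} :
    b ∈ fiber ((l : ℕ) ^ k) ((((l : ℕ) ^ k : ℕ) : ZProd m) * v) ↔ (∀ p ≠ l, b p = v p) ∧
      ((l : ℕ) : ZMod (qp m l)) ^ k * b l = ((l : ℕ) : ZMod (qp m l)) ^ k * v l := by
  rw [mem_fiber, funext_iff]
  have hp : ∀ p (w : ZProd m), ((((l : ℕ) ^ k : ℕ) : ZProd m) * w) p =
      ((l : ℕ) : ZMod (qp m p)) ^ k * w p := fun p w => by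
    rw [Pi.mul_apply, Pi.natCast_apply, Nat.cast_pow]
  simp only [hp]
  refine ⟨fun h => ⟨fun p hpl => ?_, h l⟩, fun h p => ?_⟩
  · have := h p
    rw [← coe_frob hpl, ← Units.val_pow_eq_pow_val] at this
    exact (Units.mul_right_inj _).1 this
  · by_cases hpl : p = l
    · subst hpl
      exact h.2
    · rw [h.1 p hpl]

/-- With `e` the exponent of `l`, the `l`-coordinate is free in the first fibre and a nonunit in the
second. The difference of the distribution relations for `l ^ e` and `l ^ (e - 1)` is thus the
relation attached to `l`. -/
theorem sum_fiber_prime_pow {A : Type*} [AddCommMonoid A] (φ : ZProd m → A) (l : m.primeFactors)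
    {x : Pt (GP m)} (hx : x l = 0) :
    ∑ b ∈ fiber ((l : ℕ) ^ m.factorization l) ((((l : ℕ) ^ m.factorization l : ℕ) : ZProd m) * pval x), φ b =
      ∑ b ∈ fiber ((l : ℕ) ^ (m.factorization l - 1))
        ((((l : ℕ) ^ (m.factorization l - 1) : ℕ) : ZProd m) * pval x), φ b +
      ∑ u : GP m l, φ (pval (Function.update x l (u : WithZero (GP m l)))) := by
  classical
  have he := factorization_ne_zero m l
  set e := m.factorization l with he_def
  have hxl : pval x l = 0 := pval_apply_eq_zero_iff.2 hx
  have hinj : Function.Injective fun u : GP m l =>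
      pval (Function.update x l (u : WithZero (GP m l))) := by
    intro u v h
    simpa using congrFun (pval_injective h) l
  have hval : ∀ u : GP m l, pval (Function.update x l (u : WithZero (GP m l))) =
      Function.update (pval x) l (u : ZMod (qp m l)) := by
    intro u
    funext p
    by_cases hp : p = l
    · subst hp
      rw [Function.update_self, pval, Function.update_self, wval_coe]
    · rw [Function.update_of_ne hp, pval, Function.update_of_ne hp, pval]
  have hpow : ((l : ℕ) : ZMod (qp m l)) ^ e = 0 := prime_pow_eq_zero_iff.2 le_rfl
  rw [← Finset.sum_image (s := Finset.univ)
    (g := fun u : GP m l => pval (Function.update x l (u : WithZero (GP m l))))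
    fun _ _ _ _ h => hinj h, ← Finset.sum_union]
  · congr 1
    ext b
    rw [Finset.mem_union, mem_fiber_prime_pow, mem_fiber_prime_pow, hxl, hpow, mul_zero, zero_mul]
    simp only [Finset.mem_image, Finset.mem_univ, true_and, hval, and_true]
    constructor
    · intro h
      by_cases hb : b l = 0
      · exact Or.inl ⟨h, by rw [hb, mul_zero]⟩
      obtain ⟨u, hu, hlt⟩ := exists_eq_pow_mul_unit hb
      by_cases hlev : lev l (b l) = 0
      · refine Or.inr ⟨u, ?_⟩
        rw [hlev, pow_zero, one_mul] at hu
        funext p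
        by_cases hp : p = l
        · subst hp
          rw [Function.update_self, hu]
        · rw [Function.update_of_ne hp, h p hp]
      · refine Or.inl ⟨h, ?_⟩
        rw [hu, ← mul_assoc, ← pow_add, prime_pow_eq_zero_iff.2 (by omega), zero_mul, mul_zero]
    · rintro (h | ⟨u, rfl⟩) p hp
      · exact h.1 p hp
      · exact Function.update_of_ne hp _ _
  · rw [Finset.disjoint_left]
    intro b hb hb'
    obtain ⟨u, -, rfl⟩ := Finset.mem_image.1 hb'
    rw [mem_fiber_prime_pow, hxl, mul_zero, hval, Function.update_self] at hb
    exact pow_mul_unit_ne_zero (by omega) u hb.2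

end Composite

/-! ### Comparison of the presented module with `U m` -/

section Level

theorem mem_fracGroup_iff {n m : ℕ} (a : Level m) :
    (a : QmodZ) ∈ fracGroup n m ↔ ∃ b : Level m, n • b = a := by
  constructor
  · intro h
    obtain ⟨k, hk⟩ := AddSubgroup.mem_zmultiples_iff.1 h
    refine ⟨⟨_, AddSubgroup.mem_zmultiples_iff.2 ⟨k, rfl⟩⟩, Subtype.ext ?_⟩
    rw [← hk]
    change n • (k • ((((1 : ℕ) : ℚ) / m : ℚ) : QmodZ)) = k • _
    rw [smul_comm, ← AddCircle.coe_nsmul, nsmul_eq_mul, Nat.cast_one, mul_one_div]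
  · rintro ⟨⟨b, hb⟩, rfl⟩
    obtain ⟨k, rfl⟩ := AddSubgroup.mem_zmultiples_iff.1 hb
    refine AddSubgroup.mem_zmultiples_iff.2 ⟨k, ?_⟩
    change k • _ = n • (k • ((((1 : ℕ) : ℚ) / m : ℚ) : QmodZ))
    rw [smul_comm n, ← AddCircle.coe_nsmul, nsmul_eq_mul, Nat.cast_one, mul_one_div]

variable (m : ℕ) [NeZero m]

theorem card_level : Nat.card (Level m) = m := by
  refine (Nat.card_zmultiples _).trans ?_
  rw [Nat.cast_one]
  exact AddCircle.addOrderOf_period_div (p := (1 : ℚ)) (Nat.pos_of_ne_zero (NeZero.ne m))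

instance : IsAddCyclic (Level m) :=
  inferInstanceAs (IsAddCyclic (AddSubgroup.zmultiples _))

/-- The identification of `(1/m)ℤ/ℤ` with `ℤ/m`. -/
noncomputable def levelZMod : Level m ≃+ ZMod m :=
  (zmodAddCyclicAddEquiv (G := Level m) inferInstance).symm.trans
    (ZMod.ringEquivCongr (card_level m)).toAddEquiv

/-- The identification of `(1/m)ℤ/ℤ` with the product of the primary components of `ℤ/m`. -/
noncomputable def levelEquiv : Level m ≃+ ZProd m :=
  (levelZMod m).trans (ZMod.equivPi m (NeZero.ne m)).toAddEquiv

variable {m}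

theorem neg_one_val_nsmul (a : Level m) : (((-1 : (ZMod m)ˣ) : ZMod m)).val • a = -a := by
  rw [eq_neg_iff_add_eq_zero, ← succ_nsmul]
  have h : (((-1 : (ZMod m)ˣ) : ZMod m)).val + 1 ≡ m [MOD m] := by
    rw [← ZMod.natCast_eq_natCast_iff]
    simp
  rw [val_nsmul_congr m h, level_nsmul_eq_zero]

theorem fiberSum_eq (n : ℕ) (a : Level m) : fiberSum m n a =
    ∑ b ∈ fiber n (levelEquiv m a), Finsupp.single ((levelEquiv m).symm b) 1 := by
  classical
  refine Finset.sum_bij (fun b _ => levelEquiv m b) ?_ ?_ ?_ ?_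
  · intro b hb
    rw [mem_fiber, ← nsmul_eq_mul, ← map_nsmul]
    exact congrArg _ (Finset.mem_filter.1 hb).2
  · intro a _ b _ h
    exact (levelEquiv m).injective h
  · intro b hb
    refine ⟨(levelEquiv m).symm b, Finset.mem_filter.2 ⟨Finset.mem_univ _, ?_⟩, by simp⟩
    rw [← map_nsmul, nsmul_eq_mul, mem_fiber.1 hb, AddEquiv.symm_apply_apply]
  · intro b _
    rw [AddEquiv.symm_apply_apply]

variable (m) in
/-- The map from the free group on the points to the free group on `(1/m)ℤ/ℤ`. -/
noncomputable def toLevel : FreePt (GP m) →ₗ[ℤ] FreeLevel m :=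
  Finsupp.linearCombination ℤ fun x => Finsupp.single ((levelEquiv m).symm (pval x)) 1

variable (m) in
/-- The map from the free group on `(1/m)ℤ/ℤ` to the free group on the points. -/
noncomputable def ofLevel : FreeLevel m →ₗ[ℤ] FreePt (GP m) :=
  Finsupp.linearCombination ℤ fun a => liftSum (levelEquiv m a)

theorem toLevel_single (x : Pt (GP m)) : toLevel m (Finsupp.single x 1) =
    Finsupp.single ((levelEquiv m).symm (pval x)) 1 := by
  simp [toLevel]

theorem ofLevel_single (a : Level m) :
    ofLevel m (Finsupp.single a 1) = liftSum (levelEquiv m a) := by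
  simp [ofLevel]

theorem ofLevel_toLevel (y : FreePt (GP m)) : ofLevel m (toLevel m y) = y := by
  have : ofLevel m ∘ₗ toLevel m = LinearMap.id := lhom_ext_single fun x => by
    rw [LinearMap.comp_apply, toLevel_single, ofLevel_single, AddEquiv.apply_symm_apply,
      liftSum_pval, LinearMap.id_apply]
  exact LinearMap.congr_fun this y

theorem single_sub_sum_fiber_mem {n : ℕ} (hn : n ∣ m) (b : ZProd m) :
    Finsupp.single ((levelEquiv m).symm ((n : ZProd m) * b)) 1 -
      ∑ b' ∈ fiber n ((n : ZProd m) * b), Finsupp.single ((levelEquiv m).symm b') 1 ∈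
      distRel m := by
  refine Submodule.subset_span ⟨n, (levelEquiv m).symm ((n : ZProd m) * b), hn, ?_, ?_⟩
  · rw [mem_fracGroup_iff]
    exact ⟨(levelEquiv m).symm b, by rw [← map_nsmul, nsmul_eq_mul]⟩
  · rw [fiberSum_eq, AddEquiv.apply_symm_apply]

/-- As `ofLevel` is a left inverse of `toLevel`, this yields injectivity of the comparison map on
quotients. -/
theorem ofLevel_mem_rel {x : FreeLevel m} (hx : x ∈ distRel m) :
    ofLevel m x ∈ rel (twist m) Finset.univ := by
  suffices distRel m ≤ (rel (twist m) Finset.univ).comap (ofLevel m) from this hx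
  refine Submodule.span_le.2 ?_
  rintro _ ⟨n, a, hn, ha, rfl⟩
  obtain ⟨b, rfl⟩ := (mem_fracGroup_iff a).1 ha
  rw [SetLike.mem_coe, Submodule.mem_comap, map_sub, ofLevel_single, fiberSum_eq, map_sum]
  simp only [ofLevel_single, AddEquiv.apply_symm_apply, map_nsmul, nsmul_eq_mul]
  exact liftSum_sub_sum_fiber_mem (NeZero.ne m) n hn _

theorem toLevel_mem_distRel {y : FreePt (GP m)} (hy : y ∈ rel (twist m) Finset.univ) :
    toLevel m y ∈ distRel m := by
  suffices rel (twist m) Finset.univ ≤ (distRel m).comap (toLevel m) from this hy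
  refine iSup₂_le fun l _ => ?_
  rintro _ ⟨a, rfl⟩
  rw [Submodule.mem_comap, ← Submodule.Quotient.mk_eq_zero]
  have : (distRel m).mkQ ∘ₗ toLevel m ∘ₗ relOp (twist m) l = 0 := by
    refine lhom_ext_single fun x => ?_
    rw [LinearMap.zero_apply, LinearMap.comp_apply, LinearMap.comp_apply, Submodule.mkQ_apply,
      Submodule.Quotient.mk_eq_zero]
    by_cases hx : x l = 0
    · have hdvd : (l : ℕ) ^ m.factorization l ∣ m := Nat.ordProj_dvd m l
      have h1 := single_sub_sum_fiber_mem hdvd (pval x)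
      have h2 := single_sub_sum_fiber_mem ((pow_dvd_pow (l : ℕ) (Nat.sub_le _ 1)).trans hdvd)
        (pval x)
      rw [sum_fiber_prime_pow _ l hx] at h1
      have h3 := sub_mem h2 h1
      rw [relOp_twist_single hx]
      simp only [map_sub, map_add, map_sum, toLevel_single]
      change (∑ u : GP m l, _) - Finsupp.single ((levelEquiv m).symm (pval (tr (frob l ^ _) x))) 1 +
        Finsupp.single ((levelEquiv m).symm (pval (tr (frob l ^ _) x))) 1 ∈ _
      rw [pval_tr_frob_pow l _ hx, pval_tr_frob_pow l _ hx]
      convert h3 using 1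
      abel
    · rw [relOp_apply, proj_single, if_neg hx]
      simp
  exact LinearMap.congr_fun this a

theorem exists_sub_toLevel_mem (a : FreeLevel m) : ∃ y, a - toLevel m y ∈ distRel m := by
  induction a using Finsupp.induction_linear with
  | zero => exact ⟨0, by simp⟩
  | add a b ha hb =>
    obtain ⟨y, hy⟩ := ha
    obtain ⟨z, hz⟩ := hb
    exact ⟨y + z, by simpa only [map_add, add_sub_add_comm] using add_mem hy hz⟩
  | single a n =>
    obtain ⟨b, hb⟩ := exists_depth_mul_eq (levelEquiv m a)
    have h := single_sub_sum_fiber_mem (depth_dvd (NeZero.ne m) (levelEquiv m a)) b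
    rw [hb, sum_fiber_depth, AddEquiv.symm_apply_apply] at h
    refine ⟨n • liftSum (levelEquiv m a), ?_⟩
    have h1 := (distRel m).smul_mem n h
    rw [smul_sub, Finsupp.smul_single, smul_eq_mul, mul_one] at h1
    rw [map_zsmul, liftSum, map_sum]
    simpa only [toLevel_single] using h1

theorem toLevel_act_neg_one (y : FreePt (GP m)) :
    toLevel m (act (fun _ => -1) y) = rhoA m (-1) (toLevel m y) := by
  have : toLevel m ∘ₗ act (fun _ => -1) = rhoA m (-1) ∘ₗ toLevel m := lhom_ext_single fun x => by
    rw [LinearMap.comp_apply, LinearMap.comp_apply, act_single, toLevel_single, toLevel_single,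
      rhoA_single, neg_one_val_nsmul, ← map_neg]
    congr 2
    funext p
    change wval (((-1 : GP m p) : WithZero (GP m p)) * x p) = - wval (x p)
    rw [wval_coe_mul, Units.val_neg, Units.val_one, neg_one_mul]
  exact LinearMap.congr_fun this y

end Level

/-! ### The index for `U m` -/

section Index

theorem tateIndex_eq_presIndex {ι : Type} [DecidableEq ι] {G : ι → Type} [∀ i, CommGroup (G i)]
    [∀ i, Fintype (G i)] (F : Twist G) (c : ∀ i, G i) (S : Finset ι) (ε : ℤ) {B : Type*}
    [AddCommGroup B] (π : FreePt G →+ B) (hπ : Function.Surjective π)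
    (hker : ∀ a, π a = 0 ↔ a ∈ rel F S) (c' : B →+ B) (hc : ∀ a, c' (π a) = π (act c a)) :
    tateIndex c' ε = presIndex F c S ε := by
  have h1 : (cyc F c S ε).toAddSubgroup = (AddMonoidHom.id B - ε • c').ker.comap π := by
    ext a
    rw [Submodule.mem_toAddSubgroup, mem_cyc, AddSubgroup.mem_comap, AddMonoidHom.mem_ker, ← hker,
      map_sub, map_zsmul, ← hc]
    rfl
  have h2 : (bdy F c S ε).toAddSubgroup = (AddMonoidHom.id B + ε • c').range.comap π := by
    ext a
    rw [Submodule.mem_toAddSubgroup, mem_bdy, AddSubgroup.mem_comap, AddMonoidHom.mem_range]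
    constructor
    · rintro ⟨y, hy⟩
      refine ⟨π y, ?_⟩
      rw [← hker, map_sub, sub_eq_zero, map_add, map_zsmul, ← hc] at hy
      exact hy.symm
    · rintro ⟨b, hb⟩
      obtain ⟨y, rfl⟩ := hπ b
      refine ⟨y, ?_⟩
      rw [← hker, map_sub, sub_eq_zero, map_add, map_zsmul, ← hc]
      exact hb.symm
  rw [tateIndex, presIndex, h1, h2, AddSubgroup.relIndex_comap,
    AddSubgroup.map_comap_eq_self_of_surjective hπ]

theorem tateIndex_rhoU {m : ℕ} [NeZero m] (hm1 : 1 < m) (hm : m % 4 ≠ 2) {ε : ℤ}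
    (hε : ε = 1 ∨ ε = -1) :
    tateIndex (rhoU m (-1) : U m →ₗ[ℤ] U m).toAddMonoidHom ε =
      2 ^ 2 ^ (m.primeFactors.card - 1) := by
  -- An equality would force the component at `p` to be exactly 2, which `m % 4 ≠ 2` excludes.
  have hne : ∀ p : m.primeFactors, (-1 : GP m p) ≠ 1 := by
    intro p h
    have h1 : (-1 : ZMod (qp m p)) = 1 := by simpa using congrArg Units.val h
    have h2 : ((2 : ℕ) : ZMod (qp m p)) = 0 := by
      rw [Nat.cast_ofNat, ← one_add_one_eq_two]
      nth_rw 1 [← h1]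
      exact neg_add_cancel 1
    rw [ZMod.natCast_eq_zero_iff] at h2
    have hp := Nat.prime_of_mem_primeFactors p.2
    have he := factorization_ne_zero m p
    have hp2 : (p : ℕ) = 2 :=
      (Nat.prime_dvd_prime_iff_eq hp Nat.prime_two).1 ((dvd_pow_self _ he).trans h2)
    have hdvd : 2 ∣ m := hp2 ▸ Nat.dvd_of_mem_primeFactors p.2
    have h4 : 2 ^ 2 ∣ m := by omega
    rw [Nat.prime_two.pow_dvd_iff_le_factorization (NeZero.ne m), ← hp2] at h4
    have h5 : 2 ^ 2 ∣ (p : ℕ) ^ m.factorization p := by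
      conv_lhs => rw [← hp2]
      exact pow_dvd_pow _ h4
    exact absurd (h5.trans h2) (by norm_num)
  have hcard : (Finset.univ : Finset m.primeFactors).card = m.primeFactors.card := by simp
  have : Nonempty m.primeFactors := (Nat.nonempty_primeFactors.2 hm1).to_subtype
  rw [tateIndex_eq_presIndex (twist m) (fun _ => -1) Finset.univ ε
    ((distRel m).mkQ ∘ₗ toLevel m).toAddMonoidHom, presIndex_eq _ _ (fun _ => by simp) hne
    Finset.univ_nonempty hε, hcard]
  · intro b
    obtain ⟨a, rfl⟩ := Submodule.mkQ_surjective _ b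
    obtain ⟨y, hy⟩ := exists_sub_toLevel_mem a
    exact ⟨y, ((Submodule.Quotient.eq _).2 hy).symm⟩
  · intro y
    change (distRel m).mkQ (toLevel m y) = 0 ↔ _
    rw [Submodule.mkQ_apply, Submodule.Quotient.mk_eq_zero]
    exact ⟨fun h => by simpa only [ofLevel_toLevel] using ofLevel_mem_rel h, toLevel_mem_distRel⟩
  · intro y
    change rhoU m (-1) ((distRel m).mkQ (toLevel m y)) = (distRel m).mkQ (toLevel m (act _ y))
    rw [toLevel_act_neg_one]
    rfl

end Index

/-! ### Translations on `O m`, and an odd divisor -/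

section Predistribution

set_option linter.unusedSectionVars false

variable {m : ℕ} [NeZero m]

/-- The translation `[a] ↦ [a + t]`. -/
noncomputable def translate (t : Level m) : FreeLevel m →ₗ[ℤ] FreeLevel m :=
  Finsupp.lmapDomain ℤ ℤ fun a => a + t

theorem translate_single (t a : Level m) :
    translate t (Finsupp.single a 1) = Finsupp.single (a + t) 1 := by
  simp [translate]

theorem translate_fiberSum (t : Level m) (n : ℕ) (a : Level m) :
    translate t (fiberSum m n a) = fiberSum m n (a + n • t) := by
  classical
  simp only [fiberSum, map_sum, translate_single]
  refine Finset.sum_bij' (fun b _ => b + t) (fun b _ => b - t) ?_ ?_ ?_ ?_ ?_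
  · intro b hb
    simp only [Finset.mem_filter, Finset.mem_univ, true_and] at hb ⊢
    rw [nsmul_add, hb]
  · intro b hb
    simp only [Finset.mem_filter, Finset.mem_univ, true_and] at hb ⊢
    rw [nsmul_sub, hb, add_sub_cancel_right]
  · intro b _
    exact add_sub_cancel_right b t
  · intro b _
    exact sub_add_cancel b t
  · intro b _
    rfl

theorem translate_mem_predistRel (t : Level m) {x : FreeLevel m} (hx : x ∈ predistRel m) :
    translate t x ∈ predistRel m := by
  suffices predistRel m ≤ (predistRel m).comap (translate t) from this hx
  refine Submodule.span_le.2 ?_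
  rintro _ ⟨n, a, hn, hn1, ha, rfl⟩
  rw [SetLike.mem_coe, Submodule.mem_comap, translate_fiberSum]
  refine Submodule.subset_span ⟨n, _, hn, hn1, ?_, rfl⟩
  rw [mem_fracGroup_iff] at ha ⊢
  obtain ⟨b, rfl⟩ := ha
  exact ⟨b + t, nsmul_add b t n⟩

theorem fiberSum_nsmul_mem {n : ℕ} (hn : n ∣ m) (hn1 : 1 < n) (a : Level m) :
    fiberSum m n (n • a) ∈ predistRel m :=
  Submodule.subset_span ⟨n, _, hn, hn1, (mem_fracGroup_iff _).2 ⟨a, rfl⟩, rfl⟩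

open Classical in
theorem fiberSum_nsmul (n : ℕ) (a : Level m) :
    fiberSum m n (n • a) = ∑ t : Level m with n • t = 0, translate t (Finsupp.single a 1) := by
  simp only [translate_single]
  refine Finset.sum_bij' (fun b _ => b - a) (fun t _ => a + t) ?_ ?_ ?_ ?_ ?_
  · intro b hb
    simp only [Finset.mem_filter, Finset.mem_univ, true_and] at hb ⊢
    rw [nsmul_sub, hb, sub_self]
  · intro b hb
    simp only [Finset.mem_filter, Finset.mem_univ, true_and] at hb ⊢
    rw [nsmul_add, hb, add_zero]
  · intro b _
    exact add_sub_cancel a b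
  · intro b _
    exact add_sub_cancel_left a b
  · intro b _
    rw [add_sub_cancel]

-- The fibre over `n a` is `a` plus the `n`-torsion, so the relations say that the sum of the
-- translations by `n`-torsion annihilates `O m`.
open Classical in
theorem sum_translate_mem {n : ℕ} (hn : n ∣ m) (hn1 : 1 < n) (x : FreeLevel m) :
    ∑ t : Level m with n • t = 0, translate t x ∈ predistRel m := by
  have h : (predistRel m).mkQ ∘ₗ ∑ t : Level m with n • t = 0, translate t = 0 :=
    lhom_ext_single fun a => by
      rw [LinearMap.comp_apply, LinearMap.sum_apply, ← fiberSum_nsmul, LinearMap.zero_apply,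
        Submodule.mkQ_apply, Submodule.Quotient.mk_eq_zero]
      exact fiberSum_nsmul_mem hn hn1 a
  have := LinearMap.congr_fun h x
  rwa [LinearMap.comp_apply, LinearMap.sum_apply, LinearMap.zero_apply, Submodule.mkQ_apply,
    Submodule.Quotient.mk_eq_zero] at this

theorem rhoA_neg_one_single (a : Level m) :
    rhoA m (-1) (Finsupp.single a 1) = Finsupp.single (-a) 1 := by
  rw [rhoA_single, neg_one_val_nsmul]

theorem rhoA_neg_one_translate (t : Level m) (x : FreeLevel m) :
    rhoA m (-1) (translate t x) = translate (-t) (rhoA m (-1) x) := by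
  have : rhoA m (-1) ∘ₗ translate t = translate (-t) ∘ₗ rhoA m (-1) := lhom_ext_single fun a => by
    rw [LinearMap.comp_apply, LinearMap.comp_apply, translate_single, rhoA_neg_one_single,
      rhoA_neg_one_single, translate_single, neg_add]
  exact LinearMap.congr_fun this x

/-- A finite set stable under a sign without fixed points other than `0` is `{0} ∪ H ∪ -H`. -/
theorem exists_sum_eq_add_sum_neg {X : Type*} [AddCommGroup X] (Z : Finset X)
    (h0 : 0 ∈ Z) (hneg : ∀ t ∈ Z, -t ∈ Z) (hfix : ∀ t ∈ Z, -t = t → t = 0) :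
    ∃ H : Finset X, ∀ {A : Type} [AddCommGroup A] (f : X → A),
      ∑ t ∈ Z, f t = f 0 + ∑ t ∈ H, f t + ∑ t ∈ H, f (-t) := by
  classical
  obtain ⟨H, hH, hH'⟩ := exists_half (fun t : X => -t) neg_neg
  refine ⟨Z.filter (· ∈ H), fun {A} _ f => ?_⟩
  have h0H : (0 : X) ∉ H := hH 0 neg_zero
  rw [← Finset.sum_filter_add_sum_filter_not Z (· ∈ H),
    ← Finset.add_sum_erase (Z.filter (· ∉ H)) f (a := 0) (Finset.mem_filter.2 ⟨h0, h0H⟩),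
    add_left_comm, add_assoc]
  congr 2
  refine Finset.sum_bij' (fun t _ => -t) (fun t _ => -t) ?_ ?_ ?_ ?_ ?_
  · intro t ht
    obtain ⟨ht0, ht⟩ := Finset.mem_erase.1 ht
    obtain ⟨htZ, htH⟩ := Finset.mem_filter.1 ht
    have hne : -t ≠ t := fun h => ht0 (hfix t htZ h)
    exact Finset.mem_filter.2 ⟨hneg t htZ, not_not.1 (mt (hH' t hne).2 htH)⟩
  · intro t ht
    obtain ⟨htZ, htH⟩ := Finset.mem_filter.1 ht
    have hne : -t ≠ t := fun h => hH t h htH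
    refine Finset.mem_erase.2 ⟨fun h => h0H ?_, Finset.mem_filter.2 ⟨hneg t htZ, (hH' t hne).1 htH⟩⟩
    rwa [neg_eq_zero.1 h] at htH
  · intro t _
    exact neg_neg t
  · intro t _
    exact neg_neg t
  · intro t _
    rw [neg_neg]

theorem tateIndex_rhoO_of_odd {n : ℕ} (hn : n ∣ m) (hn1 : 1 < n) (hodd : Odd n) (ε : ℤ) :
    tateIndex (rhoO m (-1) : O m →ₗ[ℤ] O m).toAddMonoidHom ε = 1 := by
  classical
  rw [tateIndex, AddSubgroup.relIndex_eq_one]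
  intro x hx
  obtain ⟨a, rfl⟩ := Submodule.mkQ_surjective _ x
  obtain ⟨H, hH⟩ := exists_sum_eq_add_sum_neg (Finset.univ.filter fun t : Level m => n • t = 0)
    (by simp) (fun t ht => by simpa using ht) (fun t ht h => by
      obtain ⟨k, rfl⟩ := hodd
      have h2 : (2 * k + 1) • t = 0 := (Finset.mem_filter.1 ht).2
      have h3 : 2 • t = 0 := by
        rw [two_nsmul]
        nth_rw 1 [← h]
        exact neg_add_cancel t
      rwa [add_nsmul, mul_comm, mul_nsmul', h3, nsmul_zero, zero_add, one_nsmul] at h2)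
  set c : O m →ₗ[ℤ] O m := rhoO m (-1) with hc
  have hmk : ∀ y, c ((predistRel m).mkQ y) = (predistRel m).mkQ (rhoA m (-1) y) := fun _ => rfl
  set π := (predistRel m).mkQ with hπ
  have hx1 : π a - ε • c (π a) = 0 := hx
  have hx2 : ∀ t, π (translate t a) = ε • π (translate t (rhoA m (-1) a)) := by
    intro t
    rw [hmk, ← map_zsmul, ← map_sub, hπ, Submodule.mkQ_apply, Submodule.Quotient.mk_eq_zero] at hx1
    have h := translate_mem_predistRel t hx1
    rw [← Submodule.Quotient.mk_eq_zero, ← Submodule.mkQ_apply, ← hπ, map_sub, map_sub, map_zsmul,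
      map_zsmul, sub_eq_zero] at h
    exact h
  have h0 : translate (0 : Level m) a = a := by
    have : translate (0 : Level m) = LinearMap.id := lhom_ext_single fun b => by
      rw [translate_single, add_zero, LinearMap.id_apply]
    exact LinearMap.congr_fun this a
  have hsum := sum_translate_mem hn hn1 a
  rw [hH fun t => translate t a, h0, ← Submodule.Quotient.mk_eq_zero, ← Submodule.mkQ_apply, ← hπ,
    map_add, map_add, map_sum, map_sum] at hsum
  -- The vanishing sum gives `a` as minus the translates over `H` and over `-H`. Since `c` turns
  -- translation by `t` into translation by `-t` and `a = ε c a`, the second part is `ε c` of the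
  -- first.
  refine ⟨-∑ t ∈ H, π (translate t a), ?_⟩
  change -∑ t ∈ H, π (translate t a) + ε • c (-∑ t ∈ H, π (translate t a)) = π a
  have hc' : ε • c (-∑ t ∈ H, π (translate t a)) = -∑ t ∈ H, π (translate (-t) a) := by
    rw [map_neg, smul_neg, map_sum, Finset.smul_sum]
    congr 1
    refine Finset.sum_congr rfl fun t _ => ?_
    rw [hmk, rhoA_neg_one_translate, hx2]
  rw [hc']
  rw [add_assoc] at hsum
  rw [eq_neg_of_add_eq_zero_left hsum, neg_add]

end Predistribution

/-! ### Antiperiodic functions as a model of `O m` for a power of two -/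

section PowerOfTwo

set_option linter.unusedSectionVars false

variable {m : ℕ} [NeZero m]

theorem exists_order_four (hm : 4 ∣ m) : ∃ h q : Level m, 2 • q = h ∧ h ≠ 0 ∧ 2 • h = 0 ∧
    ∀ t : Level m, 2 • t = 0 → t = 0 ∨ t = h := by
  obtain ⟨k, rfl⟩ := hm
  have hk : k ≠ 0 := by
    rintro rfl
    exact NeZero.ne (4 * 0) rfl
  refine ⟨(levelZMod (4 * k)).symm ((2 * k : ℕ) : ZMod (4 * k)),
    (levelZMod (4 * k)).symm ((k : ℕ) : ZMod (4 * k)), ?_, ?_, ?_, ?_⟩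
  · rw [← map_nsmul, nsmul_eq_mul, ← Nat.cast_mul]
  · rw [Ne, AddEquiv.map_eq_zero_iff, ZMod.natCast_eq_zero_iff]
    intro h
    have := Nat.le_of_dvd (by omega) h
    omega
  · rw [← map_nsmul, AddEquiv.map_eq_zero_iff, nsmul_eq_mul, ← Nat.cast_mul,
      ZMod.natCast_eq_zero_iff]
    exact ⟨1, by ring⟩
  · intro t ht
    rw [← AddEquiv.map_eq_zero_iff (levelZMod (4 * k)), map_nsmul, nsmul_eq_mul,
      ← ZMod.natCast_zmod_val (levelZMod (4 * k) t), ← Nat.cast_mul,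
      ZMod.natCast_eq_zero_iff] at ht
    have hlt := ZMod.val_lt (levelZMod (4 * k) t)
    rw [AddEquiv.eq_symm_apply, ← AddEquiv.map_eq_zero_iff (levelZMod (4 * k)),
      ← ZMod.val_eq_zero, ← ZMod.natCast_zmod_val (levelZMod (4 * k) t)]
    obtain ⟨j, hj⟩ := ht
    have hj2 : j < 2 := by
      by_contra! h
      have : 4 * k * 2 ≤ 4 * k * j := Nat.mul_le_mul_left _ h
      omega
    interval_cases j
    · left
      rw [ZMod.natCast_zmod_val]
      omega
    · right
      congr 1
      omega

/-- The difference of the coefficients at `a` and `a + h`. -/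
noncomputable def coeffSub (h a : Level m) : FreeLevel m →ₗ[ℤ] ℤ := Finsupp.lapply a - Finsupp.lapply (a + h)

theorem coeffSub_apply (h a : Level m) (x : FreeLevel m) : coeffSub h a x = x a - x (a + h) := rfl

variable {h : Level m} (hh : h ≠ 0) (hh2 : 2 • h = 0) (htwo : ∀ t : Level m, 2 • t = 0 → t = 0 ∨ t = h)
include hh hh2 htwo

theorem add_add_self (a : Level m) : a + h + h = a := by
  rw [add_assoc, ← two_nsmul, hh2, add_zero]

theorem neg_eq_self_of_two : -h = h := by
  rw [neg_eq_iff_add_eq_zero, ← two_nsmul, hh2]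

theorem rhoA_neg_one_apply (x : FreeLevel m) (a : Level m) : rhoA m (-1) x a = x (-a) := by
  have : Finsupp.lapply a ∘ₗ rhoA m (-1) = Finsupp.lapply (-a) := lhom_ext_single fun b => by
    rw [LinearMap.comp_apply, rhoA_neg_one_single, Finsupp.lapply_apply, Finsupp.lapply_apply,
      Finsupp.single_apply, Finsupp.single_apply]
    simp only [neg_eq_iff_eq_neg]
  exact LinearMap.congr_fun this x

theorem coeffSub_rhoA (x : FreeLevel m) (a : Level m) :
    coeffSub h a (rhoA m (-1) x) = coeffSub h (-a) x := by
  rw [coeffSub_apply, coeffSub_apply, rhoA_neg_one_apply hh hh2 htwo, rhoA_neg_one_apply hh hh2 htwo,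
    neg_add, neg_eq_self_of_two hh hh2 htwo]

theorem exists_coeffSub_eq (y : Level m → ℤ) (hy : ∀ a, y (a + h) = -y a) :
    ∃ x : FreeLevel m, ∀ a, coeffSub h a x = y a := by
  classical
  obtain ⟨H, -, hH⟩ := exists_half (fun t : Level m => t + h) (add_add_self hh hh2 htwo)
  refine ⟨Finsupp.equivFunOnFinite.symm fun a => if a ∈ H then y a else 0, fun a => ?_⟩
  have := hH a (by simpa using hh)
  rw [coeffSub_apply, Finsupp.equivFunOnFinite_symm_apply_apply,
    Finsupp.equivFunOnFinite_symm_apply_apply]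
  by_cases ha : a ∈ H
  · rw [if_pos ha, if_neg (this.1 ha), sub_zero]
  · rw [if_neg ha, if_pos (not_not.1 (mt this.2 ha)), hy, zero_sub, neg_neg]

theorem single_add_single_mem (h2 : 2 ∣ m) (a : Level m) :
    Finsupp.single a (1 : ℤ) + Finsupp.single (a + h) 1 ∈ predistRel m := by
  classical
  have h1 := fiberSum_nsmul_mem h2 one_lt_two a
  have h3 : (Finset.univ.filter fun t : Level m => 2 • t = 0) = {0, h} := by
    ext t
    rw [Finset.mem_filter, Finset.mem_insert, Finset.mem_singleton]
    refine ⟨fun ht => htwo t ht.2, ?_⟩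
    rintro (rfl | rfl)
    · exact ⟨Finset.mem_univ _, nsmul_zero 2⟩
    · exact ⟨Finset.mem_univ _, hh2⟩
  rw [fiberSum_nsmul] at h1
  convert h1 using 1
  rw [Finset.sum_congr (s₂ := {0, h}) (by convert h3) fun _ _ => rfl, Finset.sum_pair hh.symm,
    translate_single, translate_single, add_zero]

/-- Fibre sums for even `n` are invariant under translation by `h`, and an invariant element is a
combination of the relations `[a] + [a + h]`. So `coeffSub` identifies `O m` with functions changing
sign under `h`. -/
theorem mem_predistRel_iff (heven : ∀ n, n ∣ m → 1 < n → 2 ∣ n) (h2 : 2 ∣ m) (x : FreeLevel m) :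
    x ∈ predistRel m ↔ ∀ a, coeffSub h a x = 0 := by
  classical
  constructor
  · intro hx a
    suffices predistRel m ≤ LinearMap.ker (coeffSub h a) from this hx
    refine Submodule.span_le.2 ?_
    rintro _ ⟨n, b, hn, hn1, -, rfl⟩
    obtain ⟨k, rfl⟩ := heven n hn hn1
    have hkh : (2 * k) • h = 0 := by rw [mul_comm, mul_nsmul', hh2, nsmul_zero]
    have : translate h (fiberSum m (2 * k) b) = fiberSum m (2 * k) b := by
      rw [translate_fiberSum, hkh, add_zero]
    rw [SetLike.mem_coe, LinearMap.mem_ker, coeffSub_apply, sub_eq_zero]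
    conv_rhs => rw [← this]
    exact (Finsupp.mapDomain_apply (add_left_injective h) _ a).symm
  · intro hx
    obtain ⟨H, -, hH⟩ := exists_half (fun t : Level m => t + h) (add_add_self hh hh2 htwo)
    have hper : ∀ a, x (a + h) = x a := fun a => (sub_eq_zero.1 (hx a)).symm
    have : x = ∑ a with a ∈ H, x a • (Finsupp.single a (1 : ℤ) + Finsupp.single (a + h) 1) := by
      have hsum : x = ∑ a, x a • Finsupp.single a (1 : ℤ) := by
        conv_lhs => rw [← Finsupp.sum_single x]
        rw [Finsupp.sum_fintype _ _ (by simp)]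
        simp
      conv_lhs => rw [hsum, ← Finset.sum_filter_add_sum_filter_not _ (· ∈ H)]
      simp only [smul_add, Finset.sum_add_distrib]
      congr 1
      have hne : ∀ a, a + h ≠ a := fun a => by simpa using hh
      refine Finset.sum_bij' (fun a _ => a + h) (fun a _ => a + h) ?_ ?_ ?_ ?_ ?_
      · intro a ha
        rw [Finset.mem_filter] at ha ⊢
        exact ⟨Finset.mem_univ _, not_not.1 (mt (hH a (hne a)).2 ha.2)⟩
      · intro a ha
        rw [Finset.mem_filter] at ha ⊢
        exact ⟨Finset.mem_univ _, (hH a (hne a)).1 ha.2⟩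
      · intro a _
        exact add_add_self hh hh2 htwo a
      · intro a _
        exact add_add_self hh hh2 htwo a
      · intro a _
        rw [hper, add_add_self hh hh2 htwo]
    rw [this]
    exact sum_mem fun a _ => Submodule.smul_mem _ _ (single_add_single_mem hh hh2 htwo h2 a)

/-- An odd function with a sign under negation is, up to a parity condition at the points killed
by `4`, a norm. -/
theorem exists_eq_add_comp_neg {ε : ℤ} (hε : ε * ε = 1) (y : Level m → ℤ)
    (hy : ∀ a, y (a + h) = -y a) (hneg : ∀ a, y (-a) = ε * y a)
    (heven : ∀ a : Level m, 2 • (2 • a) = 0 → 2 ∣ y a) :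
    ∃ z : Level m → ℤ, (∀ a, z (a + h) = -z a) ∧ ∀ a, y a = z a + ε * z (-a) := by
  classical
  obtain ⟨H, hH, hH'⟩ := exists_half (fun t : Level m => -t) neg_neg
  have h4 : ∀ a : Level m, -(2 • a : Level m) = 2 • a ↔ 2 • (2 • a) = 0 := fun a => by
    rw [neg_eq_iff_add_eq_zero, ← two_nsmul]
  have hadd : ∀ a, 2 • (a + h) = 2 • a := fun a => by rw [nsmul_add, hh2, add_zero]
  -- Representatives are chosen through `2 a`, which `a` and `a + h` share, to keep the sign rule
  -- under `h`. Where `2 a = -2 a` no choice is possible and `y` has to be halved.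
  refine ⟨fun a => if 2 • a ∈ H then y a else if 2 • (2 • a) = 0 then y a / 2 else 0,
    fun a => ?_, fun a => ?_⟩
  · simp only [hadd, hy]
    split_ifs with h1 h2
    · rfl
    · exact Int.neg_ediv_of_dvd (heven a h2)
    · exact neg_zero.symm
  · simp only [smul_neg, neg_eq_zero, hneg]
    by_cases ha : 2 • (2 • a) = 0
    · have hfix := (h4 a).2 ha
      have hnot := hH _ hfix
      rw [hfix, if_neg hnot, if_neg hnot, if_pos ha, if_pos ha]
      obtain ⟨w, hw⟩ := heven a ha
      have e1 : ε * y a / 2 = ε * w := by rw [hw, mul_left_comm]; simp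
      have e2 : y a / 2 = w := by rw [hw]; simp
      rw [e1, e2, ← mul_assoc, hε, hw]
      ring
    · have hiff := hH' (2 • a) (mt (h4 a).1 ha)
      by_cases haH : 2 • a ∈ H
      · rw [if_pos haH, if_neg (hiff.1 haH), if_neg ha, mul_zero, add_zero]
      · rw [if_neg haH, if_pos (not_not.1 (mt hiff.2 haH)), if_neg ha, zero_add, ← mul_assoc, hε,
          one_mul]

end PowerOfTwo

/-! ### The index for `O m` when `m` is a power of two -/

section PowerOfTwoIndex

variable {m : ℕ} [NeZero m]

theorem tateIndex_rhoO_of_even (hm : 4 ∣ m) (heven : ∀ n, n ∣ m → 1 < n → 2 ∣ n) {ε : ℤ}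
    (hε : ε = 1 ∨ ε = -1) :
    tateIndex (rhoO m (-1) : O m →ₗ[ℤ] O m).toAddMonoidHom ε = 2 := by
  obtain ⟨h, q, hq, hh, hh2, htwo⟩ := exists_order_four hm
  have h2 : 2 ∣ m := (by norm_num : 2 ∣ 4).trans hm
  have hεε : ε * ε = 1 := by rcases hε with rfl | rfl <;> norm_num
  have hmem := mem_predistRel_iff hh hh2 htwo heven h2
  -- The coefficient at `s` detects the cohomology: `s = 0` if `ε = 1`, and `s = q` if `ε = -1`, as
  -- `-q = q + h` gives `c [q] = -[q]`. At the 4-torsion points outside `{s, s + h}` the two sign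
  -- rules force `y` to vanish.
  obtain ⟨s, hs, hs2, hs3⟩ : ∃ s : Level m,
      (∀ y : Level m → ℤ, (∀ a, y (a + h) = -y a) → y (-s) = ε * y s) ∧
      (∀ y : Level m → ℤ, (∀ a, y (a + h) = -y a) → (∀ a, y (-a) = ε * y a) → 2 ∣ y s →
        ∀ a : Level m, 2 • (2 • a) = 0 → 2 ∣ y a) ∧
      Finsupp.single s (1 : ℤ) - ε • Finsupp.single (-s) 1 ∈ predistRel m := by
    have hneg2 : ∀ a : Level m, 2 • a = h → -a = a + h := fun a ha => by
      rw [neg_eq_iff_add_eq_zero, ← add_assoc, ← two_nsmul, ha, ← two_nsmul, hh2]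
    rcases hε with rfl | rfl
    · refine ⟨0, fun y _ => by rw [neg_zero, one_mul], fun y hy hneg h0 a ha => ?_, by simp⟩
      rcases htwo _ ha with h1 | h1
      · rcases htwo _ h1 with rfl | rfl
        · exact h0
        · have := hy 0
          rw [zero_add] at this
          rw [this]
          exact (dvd_neg).2 h0
      · have h3 := hneg a
        rw [hneg2 a h1, hy] at h3
        have : y a = 0 := by omega
        rw [this]
        exact dvd_zero 2
    · refine ⟨q, fun y hy => by rw [hneg2 q hq, hy, neg_one_mul], fun y hy hneg h0 a ha => ?_, ?_⟩
      · rcases htwo _ ha with h1 | h1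
        · have h3 := hneg a
          rw [neg_eq_of_add_eq_zero_left (by rwa [← two_nsmul])] at h3
          have : y a = 0 := by omega
          rw [this]
          exact dvd_zero 2
        · rcases htwo (a - q) (by rw [nsmul_sub, h1, hq, sub_self]) with h3 | h3
          · rwa [sub_eq_zero.1 h3]
          · rw [sub_eq_iff_eq_add'.1 h3, hy]
            exact (dvd_neg).2 h0
      · rw [hneg2 q hq, neg_one_smul, sub_neg_eq_add]
        exact single_add_single_mem hh hh2 htwo h2 q
  set c : O m →ₗ[ℤ] O m := rhoO m (-1) with hc
  set π := (predistRel m).mkQ with hπ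
  have hπ0 : ∀ x, π x = 0 ↔ ∀ a, coeffSub h a x = 0 := fun x => by
    rw [hπ, Submodule.mkQ_apply, Submodule.Quotient.mk_eq_zero, hmem]
  have hmk : ∀ y, c (π y) = π (rhoA m (-1) y) := fun _ => rfl
  have hodd : ∀ (x : FreeLevel m) (a : Level m), coeffSub h (a + h) x = -coeffSub h a x :=
    fun x a => by
      rw [coeffSub_apply, coeffSub_apply, add_add_self hh hh2 htwo, neg_sub]
  let ψ : O m →ₗ[ℤ] ℤ := (predistRel m).liftQ (coeffSub h s) fun x hx => (hmem x).1 hx s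
  have hψ : ∀ x, ψ (π x) = coeffSub h s x := fun x => Submodule.liftQ_apply _ _ x
  let K := (AddMonoidHom.id (O m) - ε • c.toAddMonoidHom).ker
  have hK : ∀ x, x ∈ K ↔ x - ε • c x = 0 := fun x => Iff.rfl
  let χ : K →+ ZMod 2 := ((Int.castAddHom (ZMod 2)).comp ψ.toAddMonoidHom).comp K.subtype
  have hχ : ∀ x : K, χ x = ((ψ x : ℤ) : ZMod 2) := fun _ => rfl
  rw [tateIndex, ← card_eq_relIndex χ, Nat.card_zmod]
  · intro z
    have h0 : π (Finsupp.single s 1) ∈ K := by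
      rw [hK, hmk, rhoA_neg_one_single, ← map_zsmul, ← map_sub, hπ, Submodule.mkQ_apply,
        Submodule.Quotient.mk_eq_zero]
      exact hs3
    have h1 : χ ⟨_, h0⟩ = 1 := by
      rw [hχ, hψ, coeffSub_apply]
      simp [hh]
    exact ⟨z.val • ⟨_, h0⟩, by rw [map_nsmul, h1]; simp⟩
  · rintro ⟨x, hx⟩
    obtain ⟨w, rfl⟩ := Submodule.mkQ_surjective _ x
    rw [hχ, ZMod.intCast_zmod_eq_zero_iff_dvd]
    change 2 ∣ ψ (π w) ↔ ∃ v : O m, v + ε • c v = π w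
    rw [hψ]
    constructor
    · intro h0
      have hx' : π w - ε • c (π w) = 0 := hx
      rw [hmk, ← map_zsmul, ← map_sub, hπ0] at hx'
      have hneg : ∀ a, coeffSub h (-a) w = ε * coeffSub h a w := fun a => by
        have := hx' a
        rw [map_sub, map_zsmul, coeffSub_rhoA hh hh2 htwo, smul_eq_mul, sub_eq_zero] at this
        rw [this, ← mul_assoc, hεε, one_mul]
      obtain ⟨z, hz, hyz⟩ := exists_eq_add_comp_neg hh hh2 htwo hεε (fun a => coeffSub h a w)
        (hodd w) hneg (hs2 (fun a => coeffSub h a w) (hodd w) hneg h0)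
      obtain ⟨v, hv⟩ := exists_coeffSub_eq hh hh2 htwo z hz
      refine ⟨π v, ?_⟩
      rw [hmk, ← map_zsmul, ← map_add, ← sub_eq_zero, ← map_sub, hπ0]
      intro a
      rw [map_sub, map_add, map_zsmul, coeffSub_rhoA hh hh2 htwo, hv, hv, smul_eq_mul,
        ← hyz a, sub_self]
    · rintro ⟨v, hv⟩
      obtain ⟨v, rfl⟩ := Submodule.mkQ_surjective _ v
      change π v + ε • c (π v) = π w at hv
      rw [← hψ, ← hv, hmk, map_add, map_zsmul, hψ, hψ, coeffSub_rhoA hh hh2 htwo,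
        hs (fun a => coeffSub h a v) (hodd v), smul_eq_mul, ← mul_assoc, hεε, one_mul]
      exact ⟨_, (two_mul _).symm⟩

end PowerOfTwoIndex

end UnivDist

theorem mainTheorem2 (m : ℕ) [NeZero m] (hm1 : 1 < m) (hm : m % 4 ≠ 2) :
    (∀ i : ℕ, i = 1 ∨ i = 2 →
      UnivDist.ActsTriviallyOnCohomology (UnivDist.repO m) i ∧
      UnivDist.ActsTriviallyOnCohomology (UnivDist.repU m) i) ∧
    (∀ i : ℕ, i = 1 ∨ i = 2 →
      ((∃ k : ℕ, m = 2 ^ k) →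
        Nonempty (groupCohomology (UnivDist.repO m) i ≃+ ZMod 2)) ∧
      ((¬ ∃ k : ℕ, m = 2 ^ k) →
        Subsingleton (groupCohomology (UnivDist.repO m) i))) ∧
    (∀ i : ℕ, i = 1 ∨ i = 2 →
      Nonempty (groupCohomology (UnivDist.repU m) i ≃+
        (Fin (2 ^ (m.primeFactors.card - 1)) → ZMod 2))) := by
  have hm2 : 2 < m := by
    rcases Nat.lt_or_ge 2 m with h | h
    · exact h
    · obtain rfl : m = 2 := by omega
      exact absurd rfl hm
  refine ⟨fun i hi => ⟨UnivDist.actsTriviallyOnCohomology _ hi,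
    UnivDist.actsTriviallyOnCohomology _ hi⟩, fun i hi => ⟨?_, fun hpow => ?_⟩, fun i hi => ?_⟩
  · rintro ⟨k, hk⟩
    have h4 : 4 ∣ m := by
      have : 2 ≤ k := by
        by_contra! h
        interval_cases k <;> omega
      rw [hk]
      exact pow_dvd_pow 2 this
    have heven : ∀ n, n ∣ m → 1 < n → 2 ∣ n := by
      intro n hn hn1
      rw [hk, Nat.dvd_prime_pow Nat.prime_two] at hn
      obtain ⟨j, -, rfl⟩ := hn
      exact dvd_pow_self 2 (by rintro rfl; simp at hn1)
    obtain ⟨e⟩ := UnivDist.nonempty_groupCohomology_addEquiv hm2 (UnivDist.repO m) (n := 1)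
      (fun ε hε => (UnivDist.tateIndex_rhoO_of_even h4 heven hε).trans (pow_one 2).symm) hi
    exact ⟨e.trans (LinearEquiv.funUnique (Fin 1) ℤ (ZMod 2)).toAddEquiv⟩
  · obtain ⟨k, n, hodd, hkn⟩ := Nat.exists_eq_two_pow_mul_odd (NeZero.ne m)
    have hn1 : 1 < n := by
      refine lt_of_le_of_ne hodd.pos fun h => hpow ⟨k, ?_⟩
      rw [hkn, ← h, mul_one]
    have hcard := UnivDist.card_groupCohomology hm2 (UnivDist.repO m)
      (fun ε _ => UnivDist.tateIndex_rhoO_of_odd (Dvd.intro_left _ hkn.symm) hn1 hodd ε) hi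
    exact (Nat.card_eq_one_iff_unique.1 hcard).1
  · exact UnivDist.nonempty_groupCohomology_addEquiv hm2 (UnivDist.repU m)
      (fun ε hε => UnivDist.tateIndex_rhoU hm1 hm hε) hi
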